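/- **General Variety Theorem.** Let $\mathscr C$ be a variety of finitary algebras and $\mathscr D$ a variety of finitary algebras or of ordered algebras (posets with monotone operations, specified by inequations between terms; morphisms are the order-preserving homomorphisms). Assume: (1) $\mathscr C$ and $\mathscr D$ are locally finite, i.e. free algebras on finite sets are finite; (2) epimorphisms in $\mathscr D$ are surjective; (3) $\mathscr D$ is entropic, i.e. all operations of $\mathscr D$ commute with each other; (4) $\mathscr C$ and $\mathscr D$ are predual: there is given an equivalence $S\colon\mathscr C_f\to\mathscr D_f^{op}$, with inverse $P$, between the categories of finite algebras; (5) for the free algebras $\mathbf 1_{\mathscr C},\mathbf 1_{\mathscr D}$ on one generator, the objects $O_{\mathscr C}=P\mathbf 1_{\mathscr D}$ and $O_{\mathscr D}=S\mathbf 1_{\mathscr C}$, whose underlying sets are in canonical bijection $|O_{\mathscr C}|\cong\mathscr C(\mathbf 1_{\mathscr C},P\mathbf 1_{\mathscr D})\cong\mathscr D(\mathbf 1_{\mathscr D},S\mathbf 1_{\mathscr C})\cong|O_{\mathscr D}|$, have two elements, which we label *yes* and *no* compatibly with this bijection. *Definitions.* A $\mathscr D$-monoid is a $\mathscr D$-algebra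 with a monoid structure whose multiplication is a $\mathscr D$-morphism in each argument; morphisms are the $\mathscr D$-morphisms that are monoid morphisms. The free $\mathscr D$-monoid on a set $\Sigma$ is the free $\mathscr D$-algebra $\Psi\Sigma^*$ on the set of words, with the multiplication extending concatenation. Let $\mathrm{Free}$ be the category whose objects are the finite sets $\Sigma$ and whose morphisms $\Sigma\to\Delta$ are the $\mathscr D$-monoid morphisms $\Psi\Sigma^*\to\Psi\Delta^*$. Identify languages over $\Sigma$ with maps $\Sigma^*\to|O_{\mathscr C}|$. The set $\mathrm{Reg}(\Sigma)$ of regular languages is a $\mathscr C$-algebra under the pointwise operations of $O_{\mathscr C}$. A *local variety of languages over $\Sigma$ in $\mathscr C$* is a subalgebra $V$ of $\mathrm{Reg}(\Sigma)$ closed under the derivatives $a^{-1}L=\{w: aw\in L\}$ and $La^{-1}=\{w: wa\in L\}$ for $a\in\Sigma$. For $f\colon\Psi\Sigma^*\to\Psi\Delta^*$ the $f$-preimage of a language $L\subseteq\Delta^*$ is the language over $\Sigma$ corresponding to the composite of $f$ with the $\mathscr D$-morphism $\Psi\Delta^*\to O_{\mathscr D}$ that extends the characteristic function of $L$; $V$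 is *closed under $f$-preimages of languages in $W$* if $f$-preimage restricts to a $\mathscr C$-morphism $W\to V$. Let $\mathbf{Lang}$ be the category of pairs $(\Sigma,V)$ of a finite set and a local variety over it, a morphism $(\Sigma,V)\to(\Delta,W)$ being a $\mathscr D$-monoid morphism $f\colon\Psi\Sigma^*\to\Psi\Delta^*$ such that $V$ is closed under $f$-preimages of languages in $W$. A *variety of languages in $\mathscr C$* is a global section of the projection $p\colon\mathbf{Lang}\to\mathrm{Free}$, i.e. a functor $\mathcal V$ with $p\mathcal V=\mathrm{id}$; we write $\mathcal V\Sigma=(\Sigma,V_\Sigma)$. A *pseudovariety of $\mathscr D$-monoids* is a class of finite $\mathscr D$-monoids closed under submonoids (injective, in the ordered case order-reflecting, morphisms), quotients (surjective morphisms) and finite products. To a finite local variety $W$ over $\Sigma$, with the $\mathscr C$-morphisms $o\colon W\to O_{\mathscr C}$ (membership of the empty word) and $\delta_a\colon W\to W$, $L\mapsto a^{-1}L$, belongs the $\mathscr D$-morphism $e_{SW}\colon\Psi\Sigma^*\to SW$ that sends the empty word to the element given by $\mathbf 1_{\mathscr D}\cong S O_{\mathscr C}\xrightarrow{So}SW$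 and satisfies $e_{SW}(aw)=S\delta_a(e_{SW}(w))$ for words $w$ and letters $a$. A finite $\Sigma$-generated $\mathscr D$-monoid, i.e. a surjective $\mathscr D$-monoid morphism $e\colon\Psi\Sigma^*\to M$ with $M$ finite, *corresponds* to $W$ if $e=i\circ e_{SW}$ for some $\mathscr D$-isomorphism $i\colon SW\cong M$. *Theorem.* There is a bijection $\Theta$ between the varieties of languages in $\mathscr C$ and the pseudovarieties of $\mathscr D$-monoids. It is given as follows. (a) A finite $\mathscr D$-monoid $M$ lies in $\Theta(\mathcal V)$ iff for every finite set $\Sigma$ every $\mathscr D$-monoid morphism $f\colon\Psi\Sigma^*\to M$ factors through some finite $\Sigma$-generated $\mathscr D$-monoid $\Psi\Sigma^*\to N$ corresponding to a finite local variety $W\subseteq V_\Sigma$. (b) For a pseudovariety $\mathcal Q$ and $\mathcal V=\Theta^{-1}(\mathcal Q)$, the local variety $V_\Sigma$ is the union of all finite local varieties over $\Sigma$ that correspond to a finite $\Sigma$-generated $\mathscr D$-monoid $\Psi\Sigma^*\to M$ with $M\in\mathcal Q$. (c) $\Theta$ preserves and reflects inclusion: $V_\Sigma\subseteq V'_\Sigma$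 for all finite sets $\Sigma$ iff $\Theta(\mathcal V)\subseteq\Theta(\mathcal V')$. -/

import Mathlib

open CategoryTheory Opposite FirstOrder.Language.Structure

universe u

/-! ## Varieties of (possibly ordered) algebras -/

/-- A finitary one-sorted variety of algebras or of ordered algebras: a signature of finitary
operation symbols, the information whether the algebras are ordered, and a set of axioms
`t₁ ≤ t₂` between terms (in countably many variables).
In the non-ordered case every algebra carries the discrete order, see `AlgVariety.Alg`, so that an
axiom `t₁ ≤ t₂` says `t₁ = t₂`, every homomorphism is monotone and every injective map reflects
the order: these are ordinary varieties of algebras. -/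
structure AlgVariety where
  lang : FirstOrder.Language.{u, 0}
  algebraic : lang.IsAlgebraic
  ordered : Prop
  axs : Set (lang.Term ℕ × lang.Term ℕ)

namespace AlgVariety

/-- The algebras of a variety: posets with monotone operations satisfying the axioms; the order is
discrete if the variety is not ordered. The carrier may be empty. -/
structure Alg (V : AlgVariety.{u}) where
  carrier : Type u
  [order : PartialOrder carrier]
  [str : V.lang.Structure carrier]
  funMap_mono : ∀ {n : ℕ} (σ : V.lang.Functions n),
    Monotone (fun x : Fin n → carrier => (funMap σ x : carrier))
  discrete : ¬ V.ordered → ∀ a b : carrier, a ≤ b → a = b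
  holds : ∀ p ∈ V.axs, ∀ v : ℕ → carrier, p.1.realize v ≤ p.2.realize v

attribute [instance] Alg.order Alg.str

variable {V : AlgVariety.{u}}

/-- `f` is a morphism of the variety: an order-preserving homomorphism. -/
structure Alg.IsHom (A B : V.Alg) (f : A.carrier → B.carrier) : Prop where
  monotone : Monotone f
  map_funMap : ∀ {n : ℕ} (σ : V.lang.Functions n) (x : Fin n → A.carrier),
    f (funMap σ x) = funMap σ (fun i => f (x i))

/-- Morphisms of algebras. -/
@[ext] structure Alg.Hom (A B : V.Alg) where
  toFun : A.carrier → B.carrier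
  isHom : A.IsHom B toFun

instance : Category V.Alg where
  Hom A B := Alg.Hom A B
  id A := ⟨id, monotone_id, fun _ _ => rfl⟩
  comp f g := ⟨g.toFun ∘ f.toFun, g.isHom.monotone.comp f.isHom.monotone, fun σ x => by
    simp [f.isHom.map_funMap, g.isHom.map_funMap]⟩

theorem Alg.hom_ext {A B : V.Alg} {f g : A ⟶ B} (h : ∀ x, f.toFun x = g.toFun x) : f = g :=
  Alg.Hom.ext (funext h)

theorem Alg.IsHom.realize {A B : V.Alg} {f : A.carrier → B.carrier} (hf : A.IsHom B f)
    {X : Type*} (t : V.lang.Term X) (v : X → A.carrier) :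
    f (t.realize v) = t.realize (fun x => f (v x)) := by
  induction t with
  | var x => rfl
  | func σ ts ih =>
    simp only [FirstOrder.Language.Term.realize]
    rw [hf.map_funMap]
    simp only [ih]

/-- The category of finite algebras of a variety, as a full subcategory. -/
abbrev FinAlg (V : AlgVariety.{u}) :=
  ObjectProperty.FullSubcategory (fun A : V.Alg => Finite A.carrier)

/-! ### Products and subalgebras -/

/-- The product of a family of algebras: all structure is componentwise. -/
def Alg.pi {ι : Type u} (A : ι → V.Alg) : V.Alg where
  carrier := ∀ i, (A i).carrier
  str := ⟨fun σ x i => funMap σ fun k => x k i, fun {n} r => (V.algebraic n).elim r⟩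
  funMap_mono σ x y h i := (A i).funMap_mono σ fun k =>
    (show ∀ i, x k i ≤ y k i from h k) i
  discrete hV a b h := funext fun i => (A i).discrete hV _ _ (h i)
  holds p hp v i := by
    let _ : V.lang.Structure (∀ i, (A i).carrier) :=
      ⟨fun σ x i => funMap σ fun k => x k i, fun {n} r => (V.algebraic n).elim r⟩
    have key : ∀ t : V.lang.Term ℕ, t.realize v i = t.realize (fun k => v k i) := by
      intro t
      induction t with
      | var x => rfl
      | func σ ts ih =>
        simp only [FirstOrder.Language.Term.realize, ← ih]
        rfl
    exact (key _).trans_le (((A i).holds p hp _).trans (key _).ge)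

/-- Transport of the structure of an algebra `B` along an injection `φ : X → B` with operations
`op` on `X` which `φ` preserves; the order of `X` is the one that makes `φ` order-reflecting. -/
def Alg.ofInjective (B : V.Alg) {X : Type u} (φ : X → B.carrier) (hφ : Function.Injective φ)
    (op : ∀ {n : ℕ}, V.lang.Functions n → (Fin n → X) → X)
    (hop : ∀ {n : ℕ} (σ : V.lang.Functions n) (x : Fin n → X),
      φ (op σ x) = funMap σ (fun i => φ (x i))) : V.Alg where
  carrier := X
  order := PartialOrder.lift φ hφ
  str := ⟨op, fun {n} r => (V.algebraic n).elim r⟩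
  funMap_mono σ x y h := by
    change φ (op σ x) ≤ φ (op σ y)
    rw [hop, hop]
    exact B.funMap_mono σ fun i => h i
  discrete hV a b h := hφ (B.discrete hV _ _ h)
  holds p hp v := by
    let _ : V.lang.Structure X := ⟨op, fun {n} r => (V.algebraic n).elim r⟩
    have key : ∀ t : V.lang.Term ℕ, φ (t.realize v) = t.realize (fun k => φ (v k)) := by
      intro t
      induction t with
      | var x => rfl
      | func σ ts ih =>
        simp only [FirstOrder.Language.Term.realize, ← ih]
        exact hop σ _
    change φ _ ≤ φ _
    rw [key, key]
    exact B.holds p hp _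

/-- The subalgebra carried by a subset closed under the operations. -/
def Alg.sub (B : V.Alg) (S : Set B.carrier)
    (hS : ∀ {n : ℕ} (σ : V.lang.Functions n) (x : Fin n → B.carrier),
      (∀ i, x i ∈ S) → funMap σ x ∈ S) : V.Alg :=
  B.ofInjective (X := S) Subtype.val Subtype.val_injective
    (fun σ x => ⟨funMap σ fun i => (x i).1, hS σ _ fun i => (x i).2⟩) (fun _ _ => rfl)

/-! ### Free algebras -/

/-- Two terms are identified if they agree in all algebras of the variety, under all
interpretations of the variables. -/
def termSetoid (V : AlgVariety.{u}) (X : Type u) : Setoid (V.lang.Term X) where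
  r t s := ∀ (A : V.Alg) (v : X → A.carrier), t.realize v = s.realize v
  iseqv := ⟨fun _ _ _ => rfl, fun h A v => (h A v).symm, fun h₁ h₂ A v => (h₁ A v).trans (h₂ A v)⟩

/-- The carrier of the free algebra on a set `X`: terms over `X` modulo the equations valid in the
variety. -/
def FreeCarrier (V : AlgVariety.{u}) (X : Type u) : Type u := Quotient (V.termSetoid X)

/-- The class of a term. -/
def FreeCarrier.mk {X : Type u} (t : V.lang.Term X) : V.FreeCarrier X :=
  Quotient.mk (V.termSetoid X) t

theorem FreeCarrier.mk_eq {X : Type u} {t s : V.lang.Term X} :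
    (FreeCarrier.mk t : V.FreeCarrier X) = FreeCarrier.mk s ↔
      ∀ (A : V.Alg) (v : X → A.carrier), t.realize v = s.realize v :=
  Quotient.eq (r := V.termSetoid X)

theorem FreeCarrier.mk_surjective {X : Type u} (x : V.FreeCarrier X) :
    ∃ t, FreeCarrier.mk t = x := Quotient.exists_rep x

/-- The free algebra is ordered by the inequations valid in the variety. -/
instance (X : Type u) : PartialOrder (V.FreeCarrier X) where
  le x y := ∀ t s : V.lang.Term X, FreeCarrier.mk t = x → FreeCarrier.mk s = y →
    ∀ (A : V.Alg) (v : X → A.carrier), t.realize v ≤ s.realize v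
  le_refl x t s ht hs A v := (FreeCarrier.mk_eq.1 (ht.trans hs.symm) A v).le
  le_trans x y z h₁ h₂ t s ht hs A v := by
    obtain ⟨q, hq⟩ := FreeCarrier.mk_surjective y
    exact (h₁ t q ht hq A v).trans (h₂ q s hq hs A v)
  le_antisymm x y h₁ h₂ := by
    obtain ⟨t, rfl⟩ := FreeCarrier.mk_surjective x
    obtain ⟨s, rfl⟩ := FreeCarrier.mk_surjective y
    exact FreeCarrier.mk_eq.2 fun A v => le_antisymm (h₁ t s rfl rfl A v) (h₂ s t rfl rfl A v)

theorem FreeCarrier.mk_le {X : Type u} {t s : V.lang.Term X} :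
    (FreeCarrier.mk t : V.FreeCarrier X) ≤ FreeCarrier.mk s ↔
      ∀ (A : V.Alg) (v : X → A.carrier), t.realize v ≤ s.realize v := by
  constructor
  · intro h
    exact h t s rfl rfl
  · intro h t' s' ht hs A v
    exact ((FreeCarrier.mk_eq.1 ht A v).le.trans (h A v)).trans (FreeCarrier.mk_eq.1 hs A v).ge

noncomputable instance (X : Type u) : V.lang.Structure (V.FreeCarrier X) where
  funMap σ x := FreeCarrier.mk (.func σ fun i => (FreeCarrier.mk_surjective (x i)).choose)
  RelMap {n} r := (V.algebraic n).elim r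

theorem FreeCarrier.funMap_mk {X : Type u} {n : ℕ} (σ : V.lang.Functions n)
    (t : Fin n → V.lang.Term X) :
    (funMap σ (fun i => (FreeCarrier.mk (t i) : V.FreeCarrier X)) : V.FreeCarrier X)
      = FreeCarrier.mk (.func σ t) := by
  refine FreeCarrier.mk_eq.2 fun A v => ?_
  simp only [FirstOrder.Language.Term.realize]
  congr 1
  funext i
  exact FreeCarrier.mk_eq.1 (FreeCarrier.mk_surjective (FreeCarrier.mk (t i))).choose_spec A v

/-- The free algebra `Ψ X` on a set `X`. -/
noncomputable def free (V : AlgVariety.{u}) (X : Type u) : V.Alg where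
  carrier := V.FreeCarrier X
  funMap_mono σ x y h := by
    choose t ht using fun i => FreeCarrier.mk_surjective (x i)
    choose s hs using fun i => FreeCarrier.mk_surjective (y i)
    obtain rfl : (fun i => FreeCarrier.mk (t i)) = x := funext ht
    obtain rfl : (fun i => FreeCarrier.mk (s i)) = y := funext hs
    simp only [FreeCarrier.funMap_mk]
    exact FreeCarrier.mk_le.2 fun A v =>
      A.funMap_mono σ fun i => FreeCarrier.mk_le.1 (h i) A v
  discrete hV a b h := by
    obtain ⟨t, rfl⟩ := FreeCarrier.mk_surjective a
    obtain ⟨s, rfl⟩ := FreeCarrier.mk_surjective b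
    exact FreeCarrier.mk_eq.2 fun A v => A.discrete hV _ _ (FreeCarrier.mk_le.1 h A v)
  holds p hp v := by
    choose t ht using fun i => FreeCarrier.mk_surjective (v i)
    obtain rfl : (fun i => FreeCarrier.mk (t i)) = v := funext ht
    have key : ∀ q : V.lang.Term ℕ,
        (q.realize (fun y => (FreeCarrier.mk (t y) : V.FreeCarrier X)) : V.FreeCarrier X)
          = FreeCarrier.mk (q.subst t) := by
      intro q
      induction q with
      | var x => rfl
      | func σ ts ih =>
        simp only [FirstOrder.Language.Term.realize, FirstOrder.Language.Term.subst, ih]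
        exact FreeCarrier.funMap_mk σ _
    rw [key, key]
    refine FreeCarrier.mk_le.2 fun A v => ?_
    simp only [FirstOrder.Language.Term.realize_subst]
    exact A.holds p hp _

/-- The universal map into the free algebra. -/
def ofGen {X : Type u} (x : X) : (V.free X).carrier := FreeCarrier.mk (.var x)

theorem free_induction {X : Type u} {p : (V.free X).carrier → Prop}
    (gen : ∀ x, p (ofGen x))
    (op : ∀ {n : ℕ} (σ : V.lang.Functions n) (x : Fin n → (V.free X).carrier),
      (∀ i, p (x i)) → p (funMap σ x)) (x : (V.free X).carrier) : p x := by
  obtain ⟨t, rfl⟩ := FreeCarrier.mk_surjective x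
  induction t with
  | var x => exact gen x
  | func σ ts ih =>
    rw [← FreeCarrier.funMap_mk]
    exact op σ _ ih

/-- The morphism from the free algebra that extends a map on the generators. -/
noncomputable def lift {X : Type u} {A : V.Alg} (v : X → A.carrier) : V.free X ⟶ A where
  toFun x := (FreeCarrier.mk_surjective x).choose.realize v
  isHom := by
    have key : ∀ t : V.lang.Term X,
        (FreeCarrier.mk_surjective (FreeCarrier.mk t)).choose.realize v = t.realize v :=
      fun t => FreeCarrier.mk_eq.1 (FreeCarrier.mk_surjective (FreeCarrier.mk t)).choose_spec A v
    constructor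
    · intro a b h
      obtain ⟨t, rfl⟩ := FreeCarrier.mk_surjective a
      obtain ⟨s, rfl⟩ := FreeCarrier.mk_surjective b
      exact (key t).le.trans ((FreeCarrier.mk_le.1 h A v).trans (key s).ge)
    · intro n σ x
      choose t ht using fun i => FreeCarrier.mk_surjective (x i)
      obtain rfl : (fun i => FreeCarrier.mk (t i)) = x := funext ht
      simp only [key]
      exact (congrArg (fun z => (FreeCarrier.mk_surjective z).choose.realize v)
        (FreeCarrier.funMap_mk σ t)).trans (key _)

@[simp] theorem lift_ofGen {X : Type u} {A : V.Alg} (v : X → A.carrier) (x : X) :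
    (lift v).toFun (ofGen x) = v x :=
  FreeCarrier.mk_eq.1 (FreeCarrier.mk_surjective (FreeCarrier.mk (.var x))).choose_spec A v

theorem free_hom_ext {X : Type u} {A : V.Alg} {f g : V.free X ⟶ A}
    (h : ∀ x, f.toFun (ofGen x) = g.toFun (ofGen x)) : f = g := by
  refine Alg.hom_ext fun x => ?_
  induction x using free_induction with
  | gen x => exact h x
  | op σ x ih =>
    rw [f.isHom.map_funMap, g.isHom.map_funMap]
    simp only [ih]

/-- The adjunction bijection between maps `X → |A|` and morphisms `Ψ X ⟶ A`. -/
noncomputable def freeEquiv (X : Type u) (A : V.Alg) :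
    (V.free X ⟶ A) ≃ (X → A.carrier) where
  toFun f x := f.toFun (ofGen x)
  invFun v := lift v
  left_inv _ := free_hom_ext fun x => lift_ofGen _ x
  right_inv _ := funext fun x => lift_ofGen _ x

/-! ### Conditions on varieties -/

/-- Every free algebra on a finite set is finite. -/
class IsLocallyFinite (V : AlgVariety.{u}) : Prop where
  finite_free : ∀ (X : Type u) [Finite X], Finite (V.free X).carrier

/-- All operations commute with each other. -/
class IsEntropic (V : AlgVariety.{u}) : Prop where
  entropic : ∀ (A : V.Alg) {m n : ℕ} (σ : V.lang.Functions m) (τ : V.lang.Functions n)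
    (x : Fin m → Fin n → A.carrier),
    (funMap σ (fun i => (funMap τ (fun j => x i j) : A.carrier)) : A.carrier)
      = funMap τ (fun j => (funMap σ (fun i => x i j) : A.carrier))

/-- All epimorphisms in the category of all algebras are surjective. -/
def EpisSurjective (V : AlgVariety.{u}) : Prop :=
  ∀ {A B : V.Alg} (f : A ⟶ B), Epi f → Function.Surjective f.toFun

/-- The free algebra on one generator, a finite algebra if the variety is locally finite. -/
noncomputable def one (V : AlgVariety.{u}) [V.IsLocallyFinite] : V.FinAlg :=
  ⟨V.free PUnit.{u + 1}, IsLocallyFinite.finite_free _⟩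

/-- Elements of a finite algebra are morphisms from the free algebra on one generator. -/
noncomputable def oneEquiv [V.IsLocallyFinite] (A : V.FinAlg) :
    (V.one ⟶ A) ≃ A.obj.carrier :=
  (ObjectProperty.fullyFaithfulι _).homEquiv.trans
    ((freeEquiv _ _).trans (Equiv.funUnique PUnit A.obj.carrier))

/-! ## Monoids in a variety -/

/-- A `V`-monoid: an algebra with a monoid structure whose multiplication is a bimorphism. -/
structure Mon (V : AlgVariety.{u}) extends V.Alg where
  [monoid : Monoid carrier]
  isHom_mul_left : ∀ a : carrier, toAlg.IsHom toAlg (fun b => a * b)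
  isHom_mul_right : ∀ b : carrier, toAlg.IsHom toAlg (fun a => a * b)

attribute [instance] Mon.monoid

/-- Morphisms of `V`-monoids. -/
@[ext] structure Mon.Hom (M N : V.Mon) extends Alg.Hom M.toAlg N.toAlg where
  map_one : toFun 1 = 1
  map_mul : ∀ a b, toFun (a * b) = toFun a * toFun b

instance : Category V.Mon where
  Hom M N := Mon.Hom M N
  id M := { toHom := 𝟙 M.toAlg, map_one := rfl, map_mul := fun _ _ => rfl }
  comp {M N K} f g :=
    { toHom := (show M.toAlg ⟶ N.toAlg from f.toHom) ≫ (show N.toAlg ⟶ K.toAlg from g.toHom)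
      map_one := (congrArg g.toFun f.map_one).trans g.map_one
      map_mul := fun a b => (congrArg g.toFun (f.map_mul a b)).trans (g.map_mul _ _) }

/-- The underlying morphism of algebras. -/
def Mon.Hom.alg {M N : V.Mon} (f : M ⟶ N) : M.toAlg ⟶ N.toAlg := f.toHom

/-- The product of a family of `V`-monoids. -/
def Mon.pi {ι : Type u} (M : ι → V.Mon) : V.Mon where
  toAlg := Alg.pi fun i => (M i).toAlg
  monoid := (Pi.monoid : Monoid (∀ i, (M i).carrier))
  isHom_mul_left a := ⟨fun _ _ h i => ((M i).isHom_mul_left (a i)).monotone (h i),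
    fun σ x => funext fun i => ((M i).isHom_mul_left (a i)).map_funMap σ fun k => x k i⟩
  isHom_mul_right b := ⟨fun _ _ h i => ((M i).isHom_mul_right (b i)).monotone (h i),
    fun σ x => funext fun i => ((M i).isHom_mul_right (b i)).map_funMap σ fun k => x k i⟩

/-! ### Free monoids in an entropic variety -/

/-- Multiplication of the free `V`-monoid: the unique bimorphism extending concatenation. -/
noncomputable def freeMul {X : Type u} (x y : (V.free (List X)).carrier) :
    (V.free (List X)).carrier :=
  (lift fun u : List X =>
    (lift (fun w : List X => (ofGen (u ++ w) : (V.free (List X)).carrier))).toFun y).toFun x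

theorem freeMul_isHom_right {X : Type u} (y : (V.free (List X)).carrier) :
    (V.free (List X)).IsHom (V.free (List X)) (fun x => freeMul x y) :=
  (lift _).isHom

theorem freeMul_ofGen {X : Type u} (u w : List X) :
    freeMul (ofGen u) (ofGen w : (V.free (List X)).carrier) = ofGen (u ++ w) := by
  simp [freeMul]

theorem freeMul_isHom_left [V.IsEntropic] {X : Type u} (x : (V.free (List X)).carrier) :
    (V.free (List X)).IsHom (V.free (List X)) (fun y => freeMul x y) := by
  induction x using free_induction with
  | gen u =>
    simp only [freeMul, lift_ofGen]
    exact (lift _).isHom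
  | op σ x ih =>
    have h : ∀ y, freeMul (funMap σ x) y = funMap σ (fun i => freeMul (x i) y) :=
      fun y => (freeMul_isHom_right y).map_funMap σ x
    constructor
    · intro a b hab
      simp only [h]
      exact (V.free (List X)).funMap_mono σ fun i => (ih i).monotone hab
    · intro n τ y
      simp only [h, fun i => (ih i).map_funMap τ y]
      exact IsEntropic.entropic _ σ τ _

/-- The free `V`-monoid on a set `X`, carried by the free algebra on the words over `X`. -/
noncomputable def freeMon (V : AlgVariety.{u}) [V.IsEntropic] (X : Type u) : V.Mon where
  toAlg := V.free (List X)
  monoid :=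
    { mul := freeMul
      one := ofGen []
      one_mul := fun y => by
        change freeMul (ofGen []) y = y
        induction y using free_induction with
        | gen w => exact freeMul_ofGen [] w
        | op σ y ih => rw [(freeMul_isHom_left _).map_funMap]; simp only [ih]
      mul_one := fun x => by
        change freeMul x (ofGen []) = x
        induction x using free_induction with
        | gen u => rw [freeMul_ofGen, List.append_nil]
        | op σ x ih => rw [(freeMul_isHom_right _).map_funMap]; simp only [ih]
      mul_assoc := fun x y z => by
        change freeMul (freeMul x y) z = freeMul x (freeMul y z)
        induction x using free_induction with
        | gen u =>
          induction y using free_induction with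
          | gen v =>
            induction z using free_induction with
            | gen w => simp only [freeMul_ofGen, List.append_assoc]
            | op σ z ih => simp only [(freeMul_isHom_left _).map_funMap, ih]
          | op σ y ih =>
            rw [(freeMul_isHom_left _).map_funMap, (freeMul_isHom_right _).map_funMap,
              (freeMul_isHom_right _).map_funMap, (freeMul_isHom_left _).map_funMap]
            simp only [ih]
        | op σ x ih =>
          rw [(freeMul_isHom_right _).map_funMap, (freeMul_isHom_right _).map_funMap,
            (freeMul_isHom_right _).map_funMap]
          simp only [ih] }
  isHom_mul_left := freeMul_isHom_left
  isHom_mul_right := freeMul_isHom_right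

/-- The universal property of the free `V`-monoid. -/
theorem freeMon_existsUnique [V.IsEntropic] {X : Type u} (M : V.Mon) (v : X → M.carrier) :
    ∃! f : V.freeMon X ⟶ M, ∀ x, f.toFun (ofGen [x]) = v x := by
  let g : V.free (List X) ⟶ M.toAlg := lift fun u => (u.map v).prod
  have hg : ∀ u, g.toFun (ofGen u) = (u.map v).prod := fun u => lift_ofGen _ u
  refine ⟨⟨g, hg [], fun a b => ?_⟩, fun x => (hg [x]).trans (by simp), fun f hf => ?_⟩
  · revert a b
    intro (a : (V.free (List X)).carrier) (b : (V.free (List X)).carrier)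
    change g.toFun (freeMul a b) = g.toFun a * g.toFun b
    induction a using free_induction with
    | gen u =>
      induction b using free_induction with
      | gen w => rw [freeMul_ofGen, hg, hg, hg, List.map_append, List.prod_append]
      | op σ b ih =>
        rw [(freeMul_isHom_left _).map_funMap, g.isHom.map_funMap, g.isHom.map_funMap,
          (M.isHom_mul_left _).map_funMap]
        simp only [ih]
    | op σ a ih =>
      rw [(freeMul_isHom_right _).map_funMap, g.isHom.map_funMap, g.isHom.map_funMap,
        (M.isHom_mul_right _).map_funMap]
      simp only [ih]
  · have key : f.toHom = g := by
      refine free_hom_ext fun u => ?_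
      rw [hg]
      induction u with
      | nil => exact f.map_one
      | cons x u ih =>
        have h := f.map_mul (ofGen [x]) (ofGen u)
        rw [hf, ih] at h
        rw [List.map_cons, List.prod_cons, ← h]
        exact congrArg f.toFun (freeMul_ofGen [x] u).symm
    exact Mon.Hom.ext (congrArg Alg.Hom.toFun key)

/-- The base category: its objects are the finite sets (alphabets), its morphisms are the
morphisms between the free `V`-monoids on them. -/
structure FreeMon (V : AlgVariety.{u}) where
  alphabet : Type u
  [finite : Finite alphabet]

attribute [instance] FreeMon.finite

/-- The free `V`-monoid on an alphabet. -/
noncomputable def FreeMon.mon [V.IsEntropic] (X : V.FreeMon) : V.Mon := V.freeMon X.alphabet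

noncomputable instance [V.IsEntropic] : Category V.FreeMon where
  Hom X Y := X.mon ⟶ Y.mon
  id X := 𝟙 X.mon
  comp {X Y Z} f g := (show X.mon ⟶ Y.mon from f) ≫ (show Y.mon ⟶ Z.mon from g)
  id_comp {X Y} f := Category.id_comp (show X.mon ⟶ Y.mon from f)
  comp_id {X Y} f := Category.comp_id (show X.mon ⟶ Y.mon from f)
  assoc {X Y Z W} f g h := Category.assoc (show X.mon ⟶ Y.mon from f)
    (show Y.mon ⟶ Z.mon from g) (show Z.mon ⟶ W.mon from h)

end AlgVariety

open AlgVariety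

/-! ## Predual varieties -/

/-- A dual equivalence between the finite algebras of `C` and the finite algebras of `D`, with
`S = equiv.functor` and `P = equiv.inverse`, such that the object `O_C = P 1_D` has exactly two
elements; these are labelled by the two truth values (`True` is `yes`, `False` is `no`). -/
structure Predual (C D : AlgVariety.{u}) [C.IsLocallyFinite] [D.IsLocallyFinite] where
  equiv : C.FinAlg ≌ D.FinAlgᵒᵖ
  label : (equiv.inverse.obj (op D.one)).obj.carrier ≃ Prop

namespace Predual

variable {C D : AlgVariety.{u}} [C.IsLocallyFinite] [D.IsLocallyFinite] (E : Predual C D)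

/-- The dualising object `O_C = P 1_D`. -/
noncomputable def outC : C.FinAlg := E.equiv.inverse.obj (op D.one)

/-- The dualising object `O_D = S 1_C`. -/
noncomputable def outD : D.FinAlg := (E.equiv.functor.obj C.one).unop

/-- The canonical bijection `|O_C| ≅ C(1_C, P 1_D) ≅ D(1_D, S 1_C) ≅ |O_D|`. -/
noncomputable def outEquiv : E.outC.obj.carrier ≃ E.outD.obj.carrier :=
  (oneEquiv E.outC).symm.trans
    (((E.equiv.toAdjunction.homEquiv C.one (op D.one)).symm.trans
      (opEquiv (E.equiv.functor.obj C.one) (op D.one))).trans (oneEquiv E.outD))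

/-- The identification of the two truth values with the elements of `O_D`. -/
noncomputable def labelD : E.outD.obj.carrier ≃ Prop := E.outEquiv.symm.trans E.label

/-! ### Automata and languages -/

/-- A `X`-automaton in `C`: a coalgebra `Q ⟶ O_C × Q^X`, given by its components. -/
structure Automaton (X : Type u) where
  states : C.Alg
  out : states ⟶ E.outC.obj
  next : X → (states ⟶ states)

/-- Coalgebra homomorphisms. -/
@[ext] structure Automaton.Hom {X : Type u} (Q R : E.Automaton X) where
  map : Q.states ⟶ R.states
  out_comm : map ≫ R.out = Q.out
  next_comm : ∀ a, Q.next a ≫ map = map ≫ R.next a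

/-- The `C`-algebra of all languages over `X`: a language is a map from words to `{yes, no} = |O_C|`
and the operations of `O_C` act pointwise. -/
noncomputable def languageAlg (X : Type u) : C.Alg :=
  (Alg.pi fun _ : List X => E.outC.obj).ofInjective (X := Language X)
    (fun L w => E.label.symm (w ∈ L))
    (fun _ _ h => Set.ext fun w => iff_of_eq (E.label.symm.injective (congrFun h w)))
    (fun σ L => {w | E.label (funMap σ fun i => E.label.symm (w ∈ L i))})
    (fun _ _ => funext fun _ => E.label.symm_apply_apply _)

/-- `a⁻¹L`. -/
def leftDeriv {X : Type u} (a : X) (L : Language X) : Language X := {w | a :: w ∈ L}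

/-- `La⁻¹`. -/
def rightDeriv {X : Type u} (a : X) (L : Language X) : Language X := {w | w ++ [a] ∈ L}

theorem isRegular_funMap {X : Type u} {n : ℕ} (σ : C.lang.Functions n)
    (L : Fin n → (E.languageAlg X).carrier) (hL : ∀ i, Language.IsRegular (L i)) :
    Language.IsRegular (funMap σ L : (E.languageAlg X).carrier) := by
  change Language.IsRegular
    {w | E.label (funMap σ fun i => E.label.symm (w ∈ (show Language X from L i)))}
  refine Language.IsRegular.of_finite_range_leftQuotient ?_
  have hfin : {f : Fin n → Language X |
      ∀ i, f i ∈ Set.range (Language.leftQuotient (show Language X from L i))}.Finite :=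
    Set.Finite.pi' fun i => (hL i).finite_range_leftQuotient
  refine (hfin.image fun K : Fin n → Language X =>
    ({w | E.label (funMap σ fun i => E.label.symm (w ∈ K i))} : Language X)).subset ?_
  rintro _ ⟨x, rfl⟩
  exact ⟨fun i => Language.leftQuotient (show Language X from L i) x,
    fun i => ⟨x, rfl⟩, rfl⟩

theorem isRegular_leftDeriv {X : Type u} (a : X) {L : Language X} (hL : L.IsRegular) :
    (leftDeriv a L).IsRegular := by
  refine Language.IsRegular.of_finite_range_leftQuotient
    (hL.finite_range_leftQuotient.subset ?_)
  rintro _ ⟨x, rfl⟩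
  exact ⟨a :: x, rfl⟩

theorem leftDeriv_isHom {X : Type u} (a : X) :
    (E.languageAlg X).IsHom (E.languageAlg X) (leftDeriv a) :=
  ⟨fun _ _ h w => h (a :: w), fun _ _ => rfl⟩

theorem mem_isHom {X : Type u} (w : List X) :
    (E.languageAlg X).IsHom E.outC.obj (fun L : Language X => E.label.symm (w ∈ L)) :=
  ⟨fun _ _ h => h w, fun _ _ => E.label.symm_apply_apply _⟩

/-- The automaton carried by a set of languages closed under the operations and under left
derivatives: a state is final iff it contains the empty word, and the transitions are given by left
derivatives. -/
noncomputable def subAutomaton {X : Type u} (S : Set (Language X))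
    (hop : ∀ {n : ℕ} (σ : C.lang.Functions n) (L : Fin n → (E.languageAlg X).carrier),
      (∀ i, L i ∈ S) → funMap σ L ∈ S)
    (hleft : ∀ L ∈ S, ∀ a, leftDeriv a L ∈ S) : E.Automaton X where
  states := (E.languageAlg X).sub S hop
  out :=
    { toFun := fun L => E.label.symm ([] ∈ (show Language X from L.1))
      isHom := ⟨fun _ _ h => (E.mem_isHom []).monotone h,
        fun σ L => (E.mem_isHom []).map_funMap σ fun i => (L i).1⟩ }
  next a :=
    { toFun := fun L => ⟨leftDeriv a L.1, hleft L.1 L.2 a⟩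
      isHom := ⟨fun _ _ h => (E.leftDeriv_isHom a).monotone h, fun _ _ => rfl⟩ }

/-- The automaton of all regular languages over `X`, i.e. the rational fixpoint of the functor
`O_C × (-)^X`. -/
noncomputable def reg (X : Type u) : E.Automaton X :=
  E.subAutomaton {L | L.IsRegular} (fun σ L => E.isRegular_funMap σ L)
    (fun _ hL a => isRegular_leftDeriv a hL)

/-- The automaton of regular languages is locally finite: each state lies in a finite
subautomaton. -/
theorem reg_locallyFinite {X : Type u} (L : Language X) (hL : L.IsRegular) :
    ∃ (S : Set (Language X)) (hop : ∀ {n : ℕ} (σ : C.lang.Functions n)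
      (L : Fin n → (E.languageAlg X).carrier), (∀ i, L i ∈ S) → funMap σ L ∈ S)
      (hleft : ∀ L ∈ S, ∀ a, leftDeriv a L ∈ S),
      L ∈ S ∧ (∀ K ∈ S, K.IsRegular) ∧ Finite (E.subAutomaton S hop hleft).states.carrier := by
  have := hL.finite_range_leftQuotient.to_subtype
  have : Finite (C.free (Set.range L.leftQuotient)).carrier := IsLocallyFinite.finite_free _
  let φ : C.free (Set.range L.leftQuotient) ⟶ E.languageAlg X := lift fun K => K.1
  have hgen : ∀ K, φ.toFun (ofGen K) = K.1 := fun K => lift_ofGen _ K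
  refine ⟨Set.range φ.toFun, ?_, ?_, ⟨ofGen ⟨L, [], rfl⟩, hgen _⟩, ?_, Set.finite_range φ.toFun⟩
  · intro n σ K hK
    choose k hk using hK
    obtain rfl : (fun i => φ.toFun (k i)) = K := funext hk
    exact ⟨_, φ.isHom.map_funMap σ k⟩
  · rintro _ ⟨k, rfl⟩ a
    induction k using free_induction with
    | gen K =>
      obtain ⟨_, x, rfl⟩ := K
      refine ⟨ofGen ⟨_, x ++ [a], rfl⟩, ?_⟩
      rw [hgen, hgen]
      exact Language.leftQuotient_append L x [a]
    | op σ k ih =>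
      choose j hj using ih
      refine ⟨funMap σ j, ?_⟩
      rw [φ.isHom.map_funMap, φ.isHom.map_funMap]
      exact (congrArg _ (funext hj)).trans ((E.leftDeriv_isHom a).map_funMap σ _).symm
  · rintro _ ⟨k, rfl⟩
    induction k using free_induction with
    | gen K =>
      obtain ⟨_, x, rfl⟩ := K
      rw [hgen]
      refine Language.IsRegular.of_finite_range_leftQuotient
        (hL.finite_range_leftQuotient.subset ?_)
      rintro _ ⟨y, rfl⟩
      exact ⟨x ++ y, Language.leftQuotient_append L x y⟩
    | op σ k ih =>
      rw [φ.isHom.map_funMap]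
      exact E.isRegular_funMap σ _ ih

/-- Every finite automaton has a unique homomorphism into the automaton of regular languages, which
is therefore the terminal locally finite automaton, i.e. the rational fixpoint. -/
theorem reg_existsUnique {X : Type u} (Q : E.Automaton X) [Finite Q.states.carrier] :
    ∃! _h : Automaton.Hom E Q (E.reg X), True := by
  have key : ∀ w : List X, ∃ h : Q.states ⟶ E.outC.obj, ∀ q,
      h.toFun q = Q.out.toFun (w.foldl (fun q a => (Q.next a).toFun q) q) := by
    intro w
    induction w with
    | nil => exact ⟨Q.out, fun _ => rfl⟩
    | cons a w ih =>
      obtain ⟨h, hh⟩ := ih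
      exact ⟨Q.next a ≫ h, fun q => hh _⟩
  choose ev hev using key
  have hev' : ∀ a w q, (ev (a :: w)).toFun q = (ev w).toFun ((Q.next a).toFun q) := by
    intro a w q
    rw [hev, hev]
    rfl
  let acc : Q.states.carrier → Language X := fun q => {w | E.label ((ev w).toFun q)}
  have hq : ∀ q x, (acc q).leftQuotient x
      = acc (x.foldl (fun q a => (Q.next a).toFun q) q) := by
    intro q x
    ext w
    change E.label ((ev (x ++ w)).toFun q) ↔ E.label ((ev w).toFun _)
    rw [hev, hev, List.foldl_append]
  have hreg : ∀ q, (acc q).IsRegular := fun q =>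
    Language.IsRegular.of_finite_range_leftQuotient
      ((Set.finite_range acc).subset (by rintro _ ⟨x, rfl⟩; exact ⟨_, (hq q x).symm⟩))
  refine ⟨⟨⟨fun q => ⟨acc q, hreg q⟩, ⟨?_, ?_⟩⟩, ?_, ?_⟩, trivial, ?_⟩
  · intro q r h w
    exact (E.label.symm_apply_apply _).le.trans
      (((ev w).isHom.monotone h).trans (E.label.symm_apply_apply _).ge)
  · intro n σ q
    refine Subtype.ext (Set.ext fun w => iff_of_eq ?_)
    change E.label ((ev w).toFun (funMap σ q))
      = E.label (funMap σ fun i => E.label.symm (E.label ((ev w).toFun (q i))))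
    rw [(ev w).isHom.map_funMap]
    exact congrArg _ (congrArg _ (funext fun i => (E.label.symm_apply_apply _).symm))
  · refine Alg.hom_ext fun q => ?_
    exact (E.label.symm_apply_apply _).trans (hev [] q)
  · intro a
    refine Alg.hom_ext fun q => Subtype.ext (Set.ext fun w => iff_of_eq ?_)
    exact (congrArg E.label (hev' a w q)).symm
  · intro g _
    refine Automaton.Hom.ext (Alg.hom_ext fun q => Subtype.ext ?_)
    have hg : ∀ (w : List X) (q : Q.states.carrier),
        (w ∈ (show Language X from (g.map.toFun q).1)) = E.label ((ev w).toFun q) := by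
      intro w
      induction w with
      | nil =>
        intro q
        rw [hev]
        exact E.label.symm_apply_eq.1 (congrArg (fun f => Alg.Hom.toFun f q) g.out_comm)
      | cons a w ih =>
        intro q
        rw [hev', ← ih]
        have h : g.map.toFun ((Q.next a).toFun q) = ((E.reg X).next a).toFun (g.map.toFun q) :=
          congrArg (fun f => Alg.Hom.toFun f q) (g.next_comm a)
        exact (congrArg (fun K => w ∈ (show Language X from K.1)) h).symm
    exact Set.ext fun w => iff_of_eq (hg w q)

/-- A local variety of languages over `X` in `C`: a subautomaton of the automaton of regular
languages that is closed under right derivatives. -/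
@[ext] structure LocalVariety (X : Type u) where
  langs : Set (Language X)
  regular : ∀ L ∈ langs, L.IsRegular
  funMap_mem : ∀ {n : ℕ} (σ : C.lang.Functions n) (L : Fin n → (E.languageAlg X).carrier),
    (∀ i, L i ∈ langs) → funMap σ L ∈ langs
  leftDeriv_mem : ∀ L ∈ langs, ∀ a, leftDeriv a L ∈ langs
  rightDeriv_mem : ∀ L ∈ langs, ∀ a, rightDeriv a L ∈ langs

variable {E}

/-- The automaton carried by a local variety of languages. -/
noncomputable def LocalVariety.automaton {X : Type u} (V : E.LocalVariety X) : E.Automaton X :=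
  E.subAutomaton V.langs V.funMap_mem V.leftDeriv_mem

/-- The inclusion of a local variety into the automaton of regular languages. -/
noncomputable def LocalVariety.incl {X : Type u} (V : E.LocalVariety X) :
    Automaton.Hom E V.automaton (E.reg X) where
  map :=
    { toFun := fun L => ⟨L.1, V.regular L.1 L.2⟩
      isHom := ⟨fun _ _ h => h, fun _ _ => rfl⟩ }
  out_comm := rfl
  next_comm _ := rfl

variable (E)

/-! ### Preimages, and the category of local varieties -/

/-- The morphism `Ψ X* ⟶ O_D` that extends the characteristic function of a language. -/
noncomputable def extend {X : Type u} (L : Language X) : D.free (List X) ⟶ E.outD.obj :=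
  lift fun w => E.labelD.symm (w ∈ L)

/-- The preimage of a language under a morphism of free `D`-monoids. -/
noncomputable def preimage [D.IsEntropic] {X Y : Type u} (f : D.freeMon X ⟶ D.freeMon Y)
    (L : Language Y) : Language X :=
  {w | E.labelD ((f.toHom ≫ E.extend L).toFun (ofGen w))}

variable {E}

/-- `V` is closed under `f`-preimages of languages in `W`: the map `f⁻¹` restricts to a
`C`-morphism `W ⟶ V`. -/
def LocalVariety.ClosedUnderPreimages [D.IsEntropic] {X Y : Type u} (V : E.LocalVariety X)
    (f : D.freeMon X ⟶ D.freeMon Y) (W : E.LocalVariety Y) : Prop :=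
  ∃ h : W.automaton.states ⟶ V.automaton.states,
    ∀ L : W.langs, (h.toFun L).1 = E.preimage f L.1

variable (E)


theorem extend_preimage [D.IsEntropic] {X Y : Type u} (f : D.freeMon X ⟶ D.freeMon Y)
    (L : Language Y) : E.extend (E.preimage f L) = f.toHom ≫ E.extend L :=
  free_hom_ext fun w => (lift_ofGen _ w).trans (E.labelD.symm_apply_apply _)

theorem preimage_id [D.IsEntropic] {X : Type u} (L : Language X) :
    E.preimage (𝟙 (D.freeMon X)) L = L := by
  refine Set.ext fun w => iff_of_eq ?_
  change E.labelD ((E.extend L).toFun (ofGen w)) = _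
  rw [extend, lift_ofGen]
  exact E.labelD.apply_symm_apply _

theorem preimage_comp [D.IsEntropic] {X Y Z : Type u} (f : D.freeMon X ⟶ D.freeMon Y)
    (g : D.freeMon Y ⟶ D.freeMon Z) (L : Language Z) :
    E.preimage (f ≫ g) L = E.preimage f (E.preimage g L) := by
  refine Set.ext fun w => iff_of_eq ?_
  change _ = E.labelD ((f.toHom ≫ E.extend (E.preimage g L)).toFun (ofGen w))
  rw [extend_preimage]
  rfl

/-- The objects of the category of local varieties of languages in `C`: pairs of a finite alphabet
and a local variety of languages over it. -/
structure FLang where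
  base : D.FreeMon
  lang : E.LocalVariety base.alphabet

/-- Morphisms `(X, V) ⟶ (Y, W)`: morphisms `f : Ψ X* ⟶ Ψ Y*` of `D`-monoids such that `V` is closed
under `f`-preimages of languages in `W`. -/
@[ext] structure FLang.Hom [D.IsEntropic] (V W : E.FLang) where
  hom : V.base ⟶ W.base
  closed : V.lang.ClosedUnderPreimages hom W.lang

noncomputable instance [D.IsEntropic] : Category E.FLang where
  Hom V W := FLang.Hom E V W
  id V := ⟨𝟙 V.base, 𝟙 _, fun L => (E.preimage_id L.1).symm⟩
  comp {U V W} f g := ⟨f.hom ≫ g.hom, by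
    obtain ⟨f, h, hf⟩ := f
    obtain ⟨g, k, hg⟩ := g
    refine ⟨k ≫ h, fun L => ?_⟩
    exact (hf (k.toFun L)).trans ((congrArg (E.preimage f) (hg L)).trans
      (E.preimage_comp f g L.1).symm)⟩
  id_comp f := FLang.Hom.ext (Category.id_comp f.hom)
  comp_id f := FLang.Hom.ext (Category.comp_id f.hom)
  assoc f g h := FLang.Hom.ext (Category.assoc f.hom g.hom h.hom)

/-- The projection `p` from local varieties of languages to free `D`-monoids. -/
noncomputable def p [D.IsEntropic] : E.FLang ⥤ D.FreeMon where
  obj V := V.base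
  map f := FLang.Hom.hom f

end Predual

/-- A global section of a functor `p`: a functor `s` with `p s = id`. -/
structure GlobalSection {𝓔 𝓑 : Type*} [Category 𝓔] [Category 𝓑] (p : 𝓔 ⥤ 𝓑) where
  functor : 𝓑 ⥤ 𝓔
  comp_eq : functor ⋙ p = 𝟭 𝓑

namespace Predual

variable {C D : AlgVariety.{u}} [C.IsLocallyFinite] [D.IsLocallyFinite] (E : Predual C D)

/-- A variety of languages in `C`: a global section of the projection `p`. -/
abbrev VarietyOfLanguages [D.IsEntropic] := GlobalSection E.p

variable {E}

/-- The local variety of languages over `X` in a variety of languages. -/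
noncomputable def VarietyOfLanguages.at [D.IsEntropic] (𝒱 : E.VarietyOfLanguages)
    (X : D.FreeMon) : E.LocalVariety X.alphabet :=
  cast (congrArg (fun Y : D.FreeMon => E.LocalVariety Y.alphabet) (Functor.congr_obj 𝒱.comp_eq X))
    (𝒱.functor.obj X).lang

/-! ## Generated monoids and the local correspondence -/

/-- The finite algebra carried by a finite local variety. -/
noncomputable def LocalVariety.fin {X : Type u} (W : E.LocalVariety X)
    (hW : W.langs.Finite) : C.FinAlg :=
  ⟨W.automaton.states, hW.to_subtype⟩

/-- The dual algebra `S W` of a finite local variety. -/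
noncomputable def LocalVariety.dual {X : Type u} (W : E.LocalVariety X)
    (hW : W.langs.Finite) : D.FinAlg :=
  (E.equiv.functor.obj (W.fin hW)).unop

/-- The morphism `1_D ≅ S O_C ⟶ S W` dual to the output morphism `W ⟶ O_C = P 1_D`. -/
noncomputable def LocalVariety.dualOut {X : Type u} (W : E.LocalVariety X)
    (hW : W.langs.Finite) : D.one ⟶ W.dual hW :=
  (E.equiv.functor.map (ObjectProperty.homMk W.automaton.out : W.fin hW ⟶ E.outC) ≫
    E.equiv.counit.app (op D.one)).unop

/-- The morphism `S W ⟶ S W` dual to the transition of the letter `a`. -/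
noncomputable def LocalVariety.dualNext {X : Type u} (W : E.LocalVariety X)
    (hW : W.langs.Finite) (a : X) : W.dual hW ⟶ W.dual hW :=
  (E.equiv.functor.map
    (ObjectProperty.homMk (W.automaton.next a) : W.fin hW ⟶ W.fin hW)).unop

/-- The interpretation of words in the algebra `1_D ⟶ S W ⟵ ∐_X S W`. -/
noncomputable def LocalVariety.dualWord {X : Type u} (W : E.LocalVariety X)
    (hW : W.langs.Finite) : List X → (W.dual hW).obj.carrier
  | [] => oneEquiv _ (W.dualOut hW)
  | a :: w => (W.dualNext hW a).hom.toFun (W.dualWord hW w)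

/-- The unique morphism `e_{SW} : Ψ X* ⟶ S W` of algebras for the functor `1_D + ∐_X (-)`, where
the structure of `Ψ X*` is given by the empty word and left multiplication by letters. -/
noncomputable def LocalVariety.dualMap {X : Type u} (W : E.LocalVariety X)
    (hW : W.langs.Finite) : D.free (List X) ⟶ (W.dual hW).obj :=
  lift (W.dualWord hW)

end Predual

namespace AlgVariety

variable {V : AlgVariety.{u}}

/-- A finite `X`-generated `V`-monoid: a finite quotient of the free `V`-monoid on `X`. -/
structure GenMon (V : AlgVariety.{u}) [V.IsEntropic] (X : Type u) where
  mon : V.Mon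
  finite : Finite mon.carrier
  quot : V.freeMon X ⟶ mon
  surjective : Function.Surjective quot.toFun

/-- A pseudovariety of `V`-monoids: a class of finite `V`-monoids closed under submonoids (given by
injective and order-reflecting morphisms), quotients and finite products (including the empty
product). -/
@[ext] structure Pseudovariety (V : AlgVariety.{u}) where
  mons : Set V.Mon
  finite : ∀ M ∈ mons, Finite M.carrier
  sub_mem : ∀ {M N : V.Mon} (f : N ⟶ M), Function.Injective f.toFun →
    (∀ a b, f.toFun a ≤ f.toFun b → a ≤ b) → M ∈ mons → N ∈ mons
  quot_mem : ∀ {M N : V.Mon} (f : M ⟶ N), Function.Surjective f.toFun → M ∈ mons → N ∈ mons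
  pi_mem : ∀ {ι : Type u} [Finite ι] (M : ι → V.Mon), (∀ i, M i ∈ mons) → Mon.pi M ∈ mons

end AlgVariety

namespace Predual

variable {C D : AlgVariety.{u}} [C.IsLocallyFinite] [D.IsLocallyFinite] {E : Predual C D}

/-- The finite `X`-generated `D`-monoid `M` corresponds to the finite local variety `W`: up to an
isomorphism `S W ≅ M` of `D`-algebras the quotient map of `M` is `e_{SW}`. (The monoid structure of
`S W` is the unique one that makes `e_{SW}` a morphism of `D`-monoids.) -/
def LocalVariety.Corresponds [D.IsEntropic] {X : Type u} (W : E.LocalVariety X)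
    (M : D.GenMon X) : Prop :=
  ∃ (hW : W.langs.Finite) (i : (W.dual hW).obj ≅ M.mon.toAlg),
    W.dualMap hW ≫ i.hom = M.quot.toHom

/-- The finite `X`-generated `D`-monoids corresponding to some finite local subvariety of `V`. -/
def LocalVariety.genMons [D.IsEntropic] {X : Type u} (V : E.LocalVariety X) : Set (D.GenMon X) :=
  {M | ∃ W : E.LocalVariety X, W.langs ⊆ V.langs ∧ W.Corresponds M}

end Predual

/-! Write `[w ∈ L]` for the truth value of `w ∈ L`. For a finite algebra `A` of `C`, elements `a :
1_C ⟶ A` and `x : 1_D ⟶ S A` pair to a truth value: the image of `x` under `S a : S A ⟶ O_D`, or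
equally that of `a` under the transpose `A ⟶ O_C` of `x` (`pair_eq_label`). The pairing separates
points on both sides, `S f` is adjoint to `f`, and every morphism `S A ⟶ O_D` is pairing with an
element of `A`. Hence `O_D` cogenerates the finite algebras of `D`, and the operations of `C` act on
the morphisms from a finite algebra into `O_D`.

Locally, a word `w` and a language `L` of a finite local variety `W` satisfy `pair L (e_{SW} w) = [w
∈ L]` (`pair_dualWord`). So the languages recognized by `e_{SW}`, those whose extension to `Ψ X*`
factors through it, are exactly those in `W`. As epimorphisms are surjective, `e_{SW}` is onto; the
duals of the left and right derivatives are multiplications by letters, and entropicity extends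
these to a monoid structure on `S W` (`exists_monoid`). Conversely, a finite generated monoid is
determined by the languages it recognizes, and inclusion of these languages means that one monoid is
a quotient of the other (`exists_genMon_hom`). Thus finite local varieties match finite generated
monoids (`corresponds_iff`).

Globally, every local variety is a directed union of finite ones (`exists_finite`), so `V_X` amounts
to the generated monoids whose languages lie in it. A pseudovariety is sent to the languages its
monoids recognize, a variety of languages to the monoids described in (a). The delicate point is
that a monoid corresponding to a part of `V_X` passes the test over every other alphabet `Y`
(`mem_pseudovarietyOf`): a morphism `Ψ Y* ⟶ M` lifts to `Ψ Y* ⟶ Ψ X*`, and a morphism from its image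
to `O_D` extends to `M`, because `O_D` is injective for order embeddings of finite algebras
(`exists_extension_outD`). The recognized language is then a preimage of one in `V_X`. -/

namespace AlgVariety

variable {V : AlgVariety.{u}}

/-! ### Isomorphisms, images and epimorphisms of algebras -/

@[simp] theorem Alg.id_apply (A : V.Alg) (x : A.carrier) : Alg.Hom.toFun (𝟙 A) x = x := rfl

@[simp] theorem Alg.comp_apply {A B K : V.Alg} (f : A ⟶ B) (g : B ⟶ K) (x : A.carrier) :
    Alg.Hom.toFun (f ≫ g) x = g.toFun (f.toFun x) := rfl

theorem Alg.congr_toFun {A B : V.Alg} {f g : A ⟶ B} (h : f = g) (x : A.carrier) :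
    f.toFun x = g.toFun x := h ▸ rfl

theorem Mon.hom_ext {M N : V.Mon} {f g : M ⟶ N} (h : ∀ x, f.toFun x = g.toFun x) : f = g :=
  Mon.Hom.ext (funext h)

theorem Mon.congr_toFun {M N : V.Mon} {f g : M ⟶ N} (h : f = g) (x : M.carrier) :
    f.toFun x = g.toFun x := h ▸ rfl

theorem Alg.iso_hom_inv {A B : V.Alg} (i : A ≅ B) (x : A.carrier) :
    i.inv.toFun (i.hom.toFun x) = x := Alg.congr_toFun i.hom_inv_id x

theorem Alg.iso_inv_hom {A B : V.Alg} (i : A ≅ B) (x : B.carrier) :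
    i.hom.toFun (i.inv.toFun x) = x := Alg.congr_toFun i.inv_hom_id x

/-- A bijective, order-reflecting morphism is an isomorphism. -/
theorem Alg.isIso_of_bijective {A B : V.Alg} (f : A ⟶ B) (hf : Function.Bijective f.toFun)
    (hr : ∀ a b, f.toFun a ≤ f.toFun b → a ≤ b) : IsIso f := by
  obtain ⟨g, hgf, hfg⟩ := Function.bijective_iff_has_inverse.1 hf
  refine ⟨⟨g, ⟨fun a b h => hr _ _ ?_, fun σ x => hf.1 ?_⟩⟩, Alg.hom_ext hgf, Alg.hom_ext hfg⟩
  · rwa [hfg, hfg]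
  · rw [hfg, f.isHom.map_funMap]
    simp only [hfg _]

theorem Alg.bijective_of_isIso {A B : V.Alg} (f : A ⟶ B) [IsIso f] :
    Function.Bijective f.toFun :=
  Function.bijective_iff_has_inverse.2 ⟨(inv f).toFun,
    Alg.congr_toFun (IsIso.hom_inv_id f), Alg.congr_toFun (IsIso.inv_hom_id f)⟩

theorem Alg.funMap_mem_range {A B : V.Alg} (f : A ⟶ B) {n : ℕ} (σ : V.lang.Functions n)
    (x : Fin n → B.carrier) (hx : ∀ i, x i ∈ Set.range f.toFun) :
    funMap σ x ∈ Set.range f.toFun := by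
  choose y hy using hx
  exact ⟨funMap σ y, (f.isHom.map_funMap σ y).trans (congrArg _ (funext hy))⟩

/-- The image of a morphism. -/
def Alg.range {A B : V.Alg} (f : A ⟶ B) : V.Alg :=
  B.sub (Set.range f.toFun) (Alg.funMap_mem_range f)

/-- The inclusion of the image. -/
def Alg.rangeIncl {A B : V.Alg} (f : A ⟶ B) : Alg.range f ⟶ B :=
  ⟨Subtype.val, fun _ _ h => h, fun _ _ => rfl⟩

/-- The inclusion lifted along a morphism taking values in the image. -/
def Alg.rangeLift {A B K : V.Alg} (f : A ⟶ B) (g : K ⟶ B)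
    (h : ∀ x, g.toFun x ∈ Set.range f.toFun) : K ⟶ Alg.range f :=
  ⟨fun x => ⟨g.toFun x, h x⟩, fun _ _ hxy => g.isHom.monotone hxy,
    fun σ x => Subtype.ext (g.isHom.map_funMap σ x)⟩

theorem Alg.rangeIncl_injective {A B : V.Alg} (f : A ⟶ B) :
    Function.Injective (Alg.rangeIncl f).toFun := Subtype.val_injective

theorem Alg.finite_range {A B : V.Alg} (f : A ⟶ B) [Finite A.carrier] :
    Finite (Alg.range f).carrier := (Set.finite_range f.toFun).to_subtype

/-- In a locally finite variety, a morphism with finite codomain is an epimorphism as soon as it is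
right-cancellable with respect to finite algebras. -/
theorem epi_of_finite_cancel [V.IsLocallyFinite] {A B : V.Alg} [Finite B.carrier] (f : A ⟶ B)
    (h : ∀ (Z : V.Alg) (_ : Finite Z.carrier) (s t : B ⟶ Z), f ≫ s = f ≫ t → s = t) : Epi f := by
  refine ⟨fun {Z} s t hst => ?_⟩
  -- The values of `s` and `t` lie in the range of `φ`, a subalgebra of `Z` that is finite by local
  -- finiteness; so cancellation may be tested there.
  let φ : V.free (B.carrier ⊕ B.carrier) ⟶ Z := lift (Sum.elim s.toFun t.toFun)
  have : Finite (V.free (B.carrier ⊕ B.carrier)).carrier := IsLocallyFinite.finite_free _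
  have hs : ∀ x, s.toFun x ∈ Set.range φ.toFun := fun x => ⟨ofGen (.inl x), lift_ofGen _ _⟩
  have ht : ∀ x, t.toFun x ∈ Set.range φ.toFun := fun x => ⟨ofGen (.inr x), lift_ofGen _ _⟩
  have key := h (Alg.range φ) (Alg.finite_range φ) (Alg.rangeLift φ s hs) (Alg.rangeLift φ t ht)
    (Alg.hom_ext fun x => Subtype.ext (Alg.congr_toFun hst x))
  exact Alg.hom_ext fun x => congrArg Subtype.val (Alg.congr_toFun key x)

theorem FinAlg.isIso_of_isIso_hom {A B : V.FinAlg} (f : A ⟶ B) (h : IsIso f.hom) : IsIso f :=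
  ⟨ObjectProperty.homMk (inv f.hom), InducedCategory.hom_ext (IsIso.hom_inv_id f.hom),
    InducedCategory.hom_ext (IsIso.inv_hom_id f.hom)⟩

theorem FinAlg.isIso_hom {A B : V.FinAlg} (f : A ⟶ B) [IsIso f] : IsIso f.hom :=
  inferInstanceAs (IsIso ((ObjectProperty.ι _).map f))

/-! ### Monoids -/

/-- The image of a morphism of `V`-monoids. -/
def Mon.range {M N : V.Mon} (f : M ⟶ N) : V.Mon where
  toAlg := Alg.range f.toHom
  monoid :=
    { mul := fun a b => ⟨a.1 * b.1, by
        obtain ⟨_, x, rfl⟩ := a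
        obtain ⟨_, y, rfl⟩ := b
        exact ⟨x * y, f.map_mul x y⟩⟩
      one := ⟨1, 1, f.map_one⟩
      one_mul := fun a => Subtype.ext (one_mul a.1)
      mul_one := fun a => Subtype.ext (mul_one a.1)
      mul_assoc := fun a b c => Subtype.ext (mul_assoc a.1 b.1 c.1) }
  isHom_mul_left a := ⟨fun _ _ h => (N.isHom_mul_left a.1).monotone h,
    fun σ x => Subtype.ext ((N.isHom_mul_left a.1).map_funMap σ _)⟩
  isHom_mul_right a := ⟨fun _ _ h => (N.isHom_mul_right a.1).monotone h,
    fun σ x => Subtype.ext ((N.isHom_mul_right a.1).map_funMap σ _)⟩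

/-- The inclusion of the image. -/
def Mon.rangeIncl {M N : V.Mon} (f : M ⟶ N) : Mon.range f ⟶ N where
  toHom := Alg.rangeIncl f.toHom
  map_one := rfl
  map_mul _ _ := rfl

/-- The corestriction to the image. -/
def Mon.rangeFactor {M N : V.Mon} (f : M ⟶ N) : M ⟶ Mon.range f where
  toHom := Alg.rangeLift f.toHom f.toHom fun x => ⟨x, rfl⟩
  map_one := Subtype.ext f.map_one
  map_mul a b := Subtype.ext (f.map_mul a b)

theorem Mon.rangeFactor_surjective {M N : V.Mon} (f : M ⟶ N) :
    Function.Surjective (Mon.rangeFactor f).toFun := by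
  rintro ⟨_, x, rfl⟩
  exact ⟨x, rfl⟩

theorem Mon.finite_range {M N : V.Mon} (f : M ⟶ N) [Finite N.carrier] :
    Finite (Mon.range f).carrier :=
  Subtype.finite

theorem Pseudovariety.range_mem (𝒬 : V.Pseudovariety) {M N : V.Mon} (f : M ⟶ N)
    (hN : N ∈ 𝒬.mons) : Mon.range f ∈ 𝒬.mons :=
  𝒬.sub_mem (Mon.rangeIncl f) Subtype.val_injective (fun _ _ h => h) hN

/-- Lifting a morphism of `V`-monoids along an order-embedding through which it factors as a
map. -/
theorem Mon.exists_lift {K M N : V.Mon} (f : N ⟶ M) (hf : Function.Injective f.toFun)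
    (hr : ∀ a b, f.toFun a ≤ f.toFun b → a ≤ b) (g : K ⟶ M)
    (h : ∀ x, ∃ y, f.toFun y = g.toFun x) : ∃ k : K ⟶ N, k ≫ f = g := by
  choose k hk using h
  refine ⟨⟨⟨k, ⟨fun a b hab => hr _ _ ?_, fun σ x => hf ?_⟩⟩, hf ?_, fun a b => hf ?_⟩,
    Mon.hom_ext hk⟩
  · rw [hk, hk]
    exact g.isHom.monotone hab
  · rw [hk, f.isHom.map_funMap, g.isHom.map_funMap]
    simp only [hk]
  · change f.toFun (k 1) = _
    rw [hk, f.map_one, g.map_one]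
  · change f.toFun (k _) = f.toFun (k a * k b)
    rw [hk, f.map_mul, g.map_mul, hk, hk]

/-- A morphism of algebras through which a morphism of monoids factors after a surjective morphism
of monoids is a morphism of monoids. -/
theorem Mon.exists_desc {K M N : V.Mon} (q : K ⟶ M) (hq : Function.Surjective q.toFun)
    (f : K ⟶ N) (h : M.toAlg ⟶ N.toAlg) (hh : ∀ x, h.toFun (q.toFun x) = f.toFun x) :
    ∃ k : M ⟶ N, q ≫ k = f ∧ ∀ x, k.toFun x = h.toFun x := by
  refine ⟨⟨h, ?_, fun a b => ?_⟩, Mon.hom_ext hh, fun _ => rfl⟩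
  · rw [← q.map_one, hh, f.map_one]
  · obtain ⟨a, rfl⟩ := hq a
    obtain ⟨b, rfl⟩ := hq b
    rw [← q.map_mul, hh, hh, hh, f.map_mul]

/-- The morphism into a product of `V`-monoids. -/
def Mon.piLift {ι : Type u} {M : V.Mon} {N : ι → V.Mon} (f : ∀ i, M ⟶ N i) : M ⟶ Mon.pi N where
  toFun x i := (f i).toFun x
  isHom := ⟨fun _ _ h i => (f i).isHom.monotone h,
    fun σ x => funext fun i => (f i).isHom.map_funMap σ x⟩
  map_one := funext fun i => (f i).map_one
  map_mul a b := funext fun i => (f i).map_mul a b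

/-- The projections of a product of `V`-monoids. -/
def Mon.piProj {ι : Type u} (N : ι → V.Mon) (i : ι) : Mon.pi N ⟶ N i where
  toFun x := x i
  isHom := ⟨fun _ _ h => h i, fun _ _ => rfl⟩
  map_one := rfl
  map_mul _ _ := rfl

theorem Mon.finite_pi {ι : Type u} [Finite ι] (N : ι → V.Mon) (h : ∀ i, Finite (N i).carrier) :
    Finite (Mon.pi N).carrier :=
  inferInstanceAs (Finite (∀ i, (N i).carrier))

theorem freeMon_hom_ext [V.IsEntropic] {X : Type u} {M : V.Mon} {f g : V.freeMon X ⟶ M}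
    (h : ∀ x, f.toFun (ofGen [x]) = g.toFun (ofGen [x])) : f = g :=
  (freeMon_existsUnique M fun x => g.toFun (ofGen [x])).unique h fun _ => rfl

/-- Free `V`-monoids are projective with respect to surjective morphisms. -/
theorem freeMon_projective [V.IsEntropic] {X : Type u} {M N : V.Mon} (q : M ⟶ N)
    (hq : Function.Surjective q.toFun) (f : V.freeMon X ⟶ N) :
    ∃ g : V.freeMon X ⟶ M, g ≫ q = f := by
  choose r hr using hq
  obtain ⟨g, hg, -⟩ := freeMon_existsUnique M fun x => r (f.toFun (ofGen [x]))
  exact ⟨g, freeMon_hom_ext fun x => (congrArg q.toFun (hg x)).trans (hr _)⟩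

/-- The finite generated monoid given by the image of a morphism into a finite monoid. -/
noncomputable def GenMon.ofHom [V.IsEntropic] {X : Type u} {M : V.Mon} [Finite M.carrier]
    (f : V.freeMon X ⟶ M) : V.GenMon X :=
  ⟨Mon.range f, Mon.finite_range f, Mon.rangeFactor f, Mon.rangeFactor_surjective f⟩

end AlgVariety

namespace AlgVariety

variable {V : AlgVariety.{u}} [V.IsLocallyFinite]

theorem oneEquiv_comp {A B : V.FinAlg} (x : V.one ⟶ A) (f : A ⟶ B) :
    oneEquiv B (x ≫ f) = f.hom.toFun (oneEquiv A x) := rfl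

end AlgVariety

/-! ### The pairing of a finite algebra with its dual -/

namespace Predual

variable {C D : AlgVariety.{u}} [C.IsLocallyFinite] [D.IsLocallyFinite] (E : Predual C D)

/-- The dual of a finite algebra. -/
abbrev dualObj (A : C.FinAlg) : D.FinAlg := (E.equiv.functor.obj A).unop

/-- The dual of a morphism of finite algebras. -/
abbrev dualHom {A B : C.FinAlg} (f : A ⟶ B) : E.dualObj B ⟶ E.dualObj A :=
  (E.equiv.functor.map f).unop

/-- Elements of `A` are morphisms `S A ⟶ O_D`. -/
noncomputable def toOutD (A : C.FinAlg) : A.obj.carrier ≃ (E.dualObj A ⟶ E.outD) :=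
  (oneEquiv A).symm.trans (E.equiv.fullyFaithfulFunctor.homEquiv.trans (opEquiv _ _))

/-- Elements of `S A` are morphisms `A ⟶ O_C`. -/
noncomputable def toOutC (A : C.FinAlg) : (E.dualObj A).obj.carrier ≃ (A ⟶ E.outC) :=
  (oneEquiv (E.dualObj A)).symm.trans ((opEquiv (E.equiv.functor.obj A) (op D.one)).symm.trans
    (E.equiv.toAdjunction.homEquiv A (op D.one)))

theorem toOutD_oneEquiv {A : C.FinAlg} (a : C.one ⟶ A) :
    E.toOutD A (oneEquiv A a) = E.dualHom a :=
  congrArg E.dualHom ((oneEquiv A).symm_apply_apply a)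

theorem toOutC_oneEquiv {A : C.FinAlg} (x : D.one ⟶ E.dualObj A) :
    E.toOutC A (oneEquiv _ x) = E.equiv.toAdjunction.homEquiv A (op D.one) x.op :=
  congrArg (fun y : D.one ⟶ E.dualObj A => E.equiv.toAdjunction.homEquiv A (op D.one) y.op)
    ((oneEquiv (E.dualObj A)).symm_apply_apply x)

theorem outEquiv_oneEquiv (f : C.one ⟶ E.outC) : E.outEquiv (oneEquiv E.outC f)
    = oneEquiv E.outD ((E.equiv.toAdjunction.homEquiv C.one (op D.one)).symm f).unop :=
  congrArg (fun f : C.one ⟶ E.outC =>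
    oneEquiv E.outD ((E.equiv.toAdjunction.homEquiv C.one (op D.one)).symm f).unop)
    ((oneEquiv E.outC).symm_apply_apply f)

/-- The pairing of a finite algebra with its dual. -/
noncomputable def pair {A : C.FinAlg} (a : A.obj.carrier) (x : (E.dualObj A).obj.carrier) : Prop :=
  E.labelD ((E.toOutD A a).hom.toFun x)

/-- With `a` and `x` read as morphisms from the free algebras on one generator, one side is `x ≫ S
a` and the other is `a` followed by the transpose of `x`. Naturality of the adjunction makes these
transposes of each other, which is how the bijection `|O_C| ≅ |O_D|` matches elements. -/
theorem pair_eq_label {A : C.FinAlg} (a : A.obj.carrier) (x : (E.dualObj A).obj.carrier) :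
    E.pair a x = E.label ((E.toOutC A x).hom.toFun a) := by
  refine congrArg E.label (E.outEquiv.symm_apply_eq.2 ?_)
  obtain ⟨a, rfl⟩ := (oneEquiv A).surjective a
  obtain ⟨x, rfl⟩ := (oneEquiv (E.dualObj A)).surjective x
  rw [← oneEquiv_comp, ← oneEquiv_comp, toOutD_oneEquiv, toOutC_oneEquiv, outEquiv_oneEquiv]
  refine congrArg (fun f => oneEquiv E.outD (Quiver.Hom.unop f)) ?_
  refine Eq.symm ((Adjunction.homEquiv_naturality_left_symm _ _ _).trans ?_)
  exact congrArg _ (Equiv.symm_apply_apply _ _)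

/-- Functoriality of `S` applied to the composite of `a : 1_C ⟶ A` with `f`. -/
theorem pair_dualHom {A B : C.FinAlg} (f : A ⟶ B) (a : A.obj.carrier)
    (y : (E.dualObj B).obj.carrier) :
    E.pair a ((E.dualHom f).hom.toFun y) = E.pair (f.hom.toFun a) y := by
  obtain ⟨a, rfl⟩ := (oneEquiv A).surjective a
  rw [← oneEquiv_comp]
  rw [pair, pair, toOutD_oneEquiv, toOutD_oneEquiv, dualHom, dualHom, dualHom, Functor.map_comp]
  rfl

/-- Nondegeneracy on this side comes from the bijection `toOutD`; on the other side it comes from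
`toOutC`, through `pair_eq_label`. -/
theorem pair_left_injective {A : C.FinAlg} {a b : A.obj.carrier}
    (h : ∀ x, E.pair a x = E.pair b x) : a = b :=
  (E.toOutD A).injective (InducedCategory.hom_ext (Alg.hom_ext fun x =>
    E.labelD.injective (h x)))

theorem pair_right_injective {A : C.FinAlg} {x y : (E.dualObj A).obj.carrier}
    (h : ∀ a : A.obj.carrier, E.pair a x = E.pair a y) : x = y :=
  (E.toOutC A).injective (InducedCategory.hom_ext (Alg.hom_ext fun a =>
    E.label.injective (by rw [← pair_eq_label, ← pair_eq_label, h])))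

/-- For fixed `x`, pairing with `x` is a `C`-morphism into `O_C`, by `pair_eq_label`. This carries
the operations of `C` over to the `D`-side. -/
theorem pair_funMap {A : C.FinAlg} {n : ℕ} (σ : C.lang.Functions n) (a : Fin n → A.obj.carrier)
    (x : (E.dualObj A).obj.carrier) :
    E.pair (funMap σ a) x = E.label (funMap σ fun i => E.label.symm (E.pair (a i) x)) := by
  rw [pair_eq_label, (E.toOutC A x).hom.isHom.map_funMap]
  refine congrArg E.label (congrArg _ (funext fun i => ?_))
  rw [pair_eq_label]
  exact (E.label.symm_apply_apply _).symm

/-- Fullness of `S` on the morphisms `1_C ⟶ A`. -/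
theorem exists_pair_eq {A : C.FinAlg} (g : (E.dualObj A).obj ⟶ E.outD.obj) :
    ∃ a : A.obj.carrier, ∀ x, E.labelD (g.toFun x) = E.pair a x := by
  obtain ⟨a, ha⟩ := (E.toOutD A).surjective (ObjectProperty.homMk g)
  refine ⟨a, fun x => ?_⟩
  rw [pair, ha]
  rfl

/-- Every finite algebra of `D` is a dual. -/
theorem exists_dual_iso (B : D.FinAlg) : ∃ A : C.FinAlg, Nonempty (E.dualObj A ≅ B) :=
  ⟨E.equiv.inverse.obj (op B), ⟨((E.equiv.counitIso.app (op B)).unop).symm⟩⟩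

/-- Morphisms into `O_D` separate the elements of finite algebras. -/
theorem outD_separates (B : D.Alg) [hB : Finite B.carrier] {x y : B.carrier}
    (h : ∀ g : B ⟶ E.outD.obj, g.toFun x = g.toFun y) : x = y := by
  obtain ⟨A, ⟨i⟩⟩ := E.exists_dual_iso ⟨B, hB⟩
  let j : (E.dualObj A).obj ≅ B := (ObjectProperty.ι _).mapIso i
  apply (Alg.bijective_of_isIso j.inv).1
  exact E.pair_right_injective fun a =>
    congrArg E.labelD (h (j.inv ≫ (E.toOutD A a).hom))

/-- The operations of `C` act on the morphisms from a finite algebra of `D` into `O_D`. -/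
theorem exists_outD_funMap (B : D.Alg) [hB : Finite B.carrier] {n : ℕ} (σ : C.lang.Functions n)
    (g : Fin n → (B ⟶ E.outD.obj)) : ∃ h : B ⟶ E.outD.obj, ∀ x, E.labelD (h.toFun x)
      = E.label (funMap σ fun i => E.label.symm (E.labelD ((g i).toFun x))) := by
  obtain ⟨A, ⟨i⟩⟩ := E.exists_dual_iso ⟨B, hB⟩
  let j : (E.dualObj A).obj ≅ B := (ObjectProperty.ι _).mapIso i
  choose a ha using fun i => E.exists_pair_eq (j.hom ≫ g i)
  refine ⟨j.inv ≫ (E.toOutD A (funMap σ a)).hom, fun x => (E.pair_funMap σ a _).trans ?_⟩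
  congr 2
  funext k
  rw [← ha, Alg.comp_apply, Alg.iso_inv_hom]

/-! ### Surjections, embeddings and factorizations tested by morphisms into `O_D` -/

variable {E}

/-- A morphism of finite algebras in `D` is surjective if morphisms into `O_D` can be cancelled. -/
theorem surjective_of_cancel_outD (hepi : D.EpisSurjective) {B B' : D.Alg} [Finite B'.carrier]
    (f : B ⟶ B')
    (hf : ∀ g h : B' ⟶ E.outD.obj, f ≫ g = f ≫ h → g = h) : Function.Surjective f.toFun := by
  -- It suffices that `f` be an epimorphism, which may be tested against finite `Z`; the elements of
  -- such a `Z` are separated by morphisms into `O_D`.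
  refine hepi f (epi_of_finite_cancel f fun Z _ s t hst => Alg.hom_ext fun x => ?_)
  refine E.outD_separates Z fun k => ?_
  exact Alg.congr_toFun (hf (s ≫ k) (t ≫ k) (by
    rw [← Category.assoc, hst, Category.assoc])) x

/-- Morphisms `S A ⟶ O_D` are elements of `A`, and precomposing them with `S f` is applying `f`.
Injectivity of `f` is therefore cancellability of `S f` against `O_D`. -/
theorem dualHom_surjective (hepi : D.EpisSurjective) {A B : C.FinAlg} (f : A ⟶ B)
    (hf : Function.Injective f.hom.toFun) : Function.Surjective (E.dualHom f).hom.toFun := by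
  have := (E.dualObj A).property
  refine surjective_of_cancel_outD (E := E) hepi (E.dualHom f).hom fun g h hgh => ?_
  obtain ⟨a, ha⟩ := E.exists_pair_eq g
  obtain ⟨b, hb⟩ := E.exists_pair_eq h
  have hab : a = b := hf (E.pair_left_injective fun x => by
    rw [← pair_dualHom, ← pair_dualHom, ← ha, ← hb]
    exact congrArg E.labelD (Alg.congr_toFun hgh x))
  exact Alg.hom_ext fun x => E.labelD.injective (by rw [ha, hb, hab])

/-- Morphisms into `O_D` extend along embeddings of finite algebras. -/
theorem exists_extension_outD (hepi : D.EpisSurjective) {K M : D.Alg} [hK : Finite K.carrier]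
    [hM : Finite M.carrier] (i : K ⟶ M)
    (hr : ∀ a b, i.toFun a ≤ i.toFun b → a ≤ b) (g : K ⟶ E.outD.obj) :
    ∃ h : M ⟶ E.outD.obj, i ≫ h = g := by
  obtain ⟨A, ⟨iA⟩⟩ := E.exists_dual_iso ⟨K, hK⟩
  obtain ⟨B, ⟨iB⟩⟩ := E.exists_dual_iso ⟨M, hM⟩
  let jA : (E.dualObj A).obj ≅ K := (ObjectProperty.ι _).mapIso iA
  let jB : (E.dualObj B).obj ≅ M := (ObjectProperty.ι _).mapIso iB
  let s : E.dualObj A ⟶ E.dualObj B := ObjectProperty.homMk (jA.hom ≫ i ≫ jB.inv)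
  obtain ⟨φ, hφ⟩ : ∃ φ : B ⟶ A, E.dualHom φ = s := by
    obtain ⟨φ, hφ⟩ := E.equiv.functor.map_surjective s.op
    exact ⟨φ, congrArg Quiver.Hom.unop hφ⟩
  have := A.property
  have := B.property
  -- Factor `φ` through its image as `r ≫ j`. Then `S j` is surjective because `j` is injective, and
  -- it reflects the order because following it by `S r` gives `i` up to isomorphism. Hence `S j`,
  -- and with it `j`, is an isomorphism, so `φ` is surjective.
  let I : C.FinAlg := ⟨Alg.range φ.hom, Alg.finite_range φ.hom⟩
  let j : I ⟶ A := ObjectProperty.homMk (Alg.rangeIncl φ.hom)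
  let r : B ⟶ I := ObjectProperty.homMk (Alg.rangeLift φ.hom φ.hom fun x => ⟨x, rfl⟩)
  have hrj : r ≫ j = φ := rfl
  have hs : ∀ x, (E.dualHom r).hom.toFun ((E.dualHom j).hom.toFun x)
      = jB.inv.toFun (i.toFun (jA.hom.toFun x)) := by
    intro x
    have : E.dualHom j ≫ E.dualHom r = s := by
      rw [← hφ, ← hrj, dualHom, dualHom, dualHom, Functor.map_comp, unop_comp]
    exact Alg.congr_toFun (congrArg (fun k => k.hom) this) x
  have hrefl : ∀ x y, (E.dualHom j).hom.toFun x ≤ (E.dualHom j).hom.toFun y → x ≤ y := by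
    intro x y h
    have h := (E.dualHom r).hom.isHom.monotone h
    rw [hs, hs] at h
    have h := jB.hom.isHom.monotone h
    rw [Alg.iso_inv_hom, Alg.iso_inv_hom] at h
    have h := jA.inv.isHom.monotone (hr _ _ h)
    rwa [Alg.iso_hom_inv, Alg.iso_hom_inv] at h
  have hbij : Function.Bijective (E.dualHom j).hom.toFun :=
    ⟨fun x y h => le_antisymm (hrefl _ _ h.le) (hrefl _ _ h.ge),
      dualHom_surjective hepi j (Alg.rangeIncl_injective _)⟩
  have h1 : IsIso (E.dualHom j) :=
    FinAlg.isIso_of_isIso_hom _ (Alg.isIso_of_bijective _ hbij hrefl)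
  have h2 : IsIso (E.equiv.functor.map j) := (isIso_unop_iff _).1 h1
  have h3 : IsIso j := isIso_of_reflects_iso j E.equiv.functor
  have h4 := FinAlg.isIso_hom j
  -- Up to isomorphism `g` is pairing with some `a = φ b`; pairing with `b` extends it.
  obtain ⟨a, ha⟩ := E.exists_pair_eq (jA.hom ≫ g)
  obtain ⟨⟨_, b, rfl⟩, hb⟩ := (Alg.bijective_of_isIso j.hom).2 a
  obtain rfl : φ.hom.toFun b = a := hb
  refine ⟨jB.inv ≫ (E.toOutD B b).hom, Alg.hom_ext fun x => E.labelD.injective ?_⟩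
  obtain ⟨x, rfl⟩ := (Alg.bijective_of_isIso jA.hom).2 x
  refine Eq.trans ?_ (ha x).symm
  rw [← pair_dualHom, hφ]
  rfl

/-- A morphism onto a finite algebra factors through a surjective morphism onto another one if its
composites with morphisms into `O_D` do. -/
theorem exists_factor (hC : ¬ C.ordered) {T B B' : D.Alg} [hB : Finite B.carrier]
    [hB' : Finite B'.carrier] (q : T ⟶ B) (hq : Function.Surjective q.toFun) (q' : T ⟶ B')
    (h : ∀ g : B' ⟶ E.outD.obj, ∃ g' : B ⟶ E.outD.obj, q ≫ g' = q' ≫ g) :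
    ∃ f : B ⟶ B', q ≫ f = q' := by
  obtain ⟨A, ⟨iA⟩⟩ := E.exists_dual_iso ⟨B, hB⟩
  obtain ⟨A', ⟨iA'⟩⟩ := E.exists_dual_iso ⟨B', hB'⟩
  let j : (E.dualObj A).obj ≅ B := (ObjectProperty.ι _).mapIso iA
  let j' : (E.dualObj A').obj ≅ B' := (ObjectProperty.ι _).mapIso iA'
  have key : ∀ a' : A'.obj.carrier, ∃ a : A.obj.carrier, ∀ t,
      E.pair a (j.inv.toFun (q.toFun t)) = E.pair a' (j'.inv.toFun (q'.toFun t)) := by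
    intro a'
    obtain ⟨g', hg'⟩ := h (j'.inv ≫ (E.toOutD A' a').hom)
    obtain ⟨a, ha⟩ := E.exists_pair_eq (j.hom ≫ g')
    refine ⟨a, fun t => ?_⟩
    rw [← ha, Alg.comp_apply, Alg.iso_inv_hom]
    exact congrArg E.labelD (Alg.congr_toFun hg' t)
  choose φ hφ using key
  have hsurj : ∀ x, ∃ t, j.inv.toFun (q.toFun t) = x := fun x => by
    obtain ⟨t, ht⟩ := hq (j.hom.toFun x)
    exact ⟨t, by rw [ht, Alg.iso_hom_inv]⟩
  -- The order of `C` is discrete, so `φ` is monotone for free. Compatibility with operations is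
  -- checked by pairing with the values of `q`, which exhaust `S A` up to isomorphism. The dual of
  -- `ψ` is the required factor.
  let ψ : A' ⟶ A := ObjectProperty.homMk ⟨φ, fun a b hab => by rw [A'.obj.discrete hC a b hab],
    fun σ a => E.pair_left_injective fun x => by
      obtain ⟨t, rfl⟩ := hsurj x
      rw [hφ, pair_funMap, pair_funMap]
      simp only [hφ]⟩
  refine ⟨j.inv ≫ (E.dualHom ψ).hom ≫ j'.hom, Alg.hom_ext fun t => ?_⟩
  apply (Alg.bijective_of_isIso j'.inv).1
  refine E.pair_right_injective fun a => ?_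
  refine (congrArg (E.pair a) (Alg.iso_hom_inv j' _)).trans ?_
  rw [← hφ]
  exact E.pair_dualHom ψ a _

/-! ### The evaluation of words in the dual of a finite local variety -/

/-- For the empty word, `dualOut` is the transpose of the output map, which tests membership of
`[]`. A letter acts on `S W` by the dual of the left derivative, and adjointness moves it onto `L`.
-/
theorem LocalVariety.pair_dualWord {X : Type u} (W : E.LocalVariety X) (hW : W.langs.Finite)
    (w : List X) (L : W.langs) :
    E.pair (A := W.fin hW) L (W.dualWord hW w) = (w ∈ (show Language X from L.1)) := by
  induction w generalizing L with
  | nil =>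
    refine (E.pair_eq_label _ _).trans ?_
    have : E.toOutC (W.fin hW) (W.dualWord hW []) = ObjectProperty.homMk W.automaton.out := by
      change E.toOutC (W.fin hW) (oneEquiv _ (W.dualOut hW)) = _
      refine (E.toOutC_oneEquiv _).trans ((Equiv.eq_symm_apply _).1 ?_)
      exact (Adjunction.homEquiv_counit E.equiv.toAdjunction (W.fin hW) (op D.one)
        (ObjectProperty.homMk W.automaton.out)).symm
    rw [this]
    exact E.label.apply_symm_apply _
  | cons a w ih =>
    exact (E.pair_dualHom (ObjectProperty.homMk (W.automaton.next a) : W.fin hW ⟶ W.fin hW)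
      L (W.dualWord hW w)).trans (ih _)

end Predual

/-! ### Monoid structures on quotients of the free algebra on words -/

namespace AlgVariety

variable {V : AlgVariety.{u}}

/-- The operations of an entropic variety act pointwise on morphisms. -/
def Alg.homFunMap [V.IsEntropic] {A B : V.Alg} {n : ℕ} (σ : V.lang.Functions n)
    (f : Fin n → (A ⟶ B)) : A ⟶ B where
  toFun x := funMap σ fun i => (f i).toFun x
  isHom := ⟨fun _ _ h => B.funMap_mono σ fun i => (f i).isHom.monotone h, fun τ x => by
    simp only [fun i => (f i).isHom.map_funMap τ x]
    exact IsEntropic.entropic _ σ τ _⟩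

/-- A surjective morphism from the free algebra on words is a quotient map of `V`-monoids if the
left and right multiplications by letters descend along it. -/
theorem exists_monoid [V.IsEntropic] {X : Type u} {B : V.Alg} (e : V.free (List X) ⟶ B)
    (he : Function.Surjective e.toFun)
    (hl : ∀ a : X, ∃ l : B ⟶ B, ∀ w, l.toFun (e.toFun (ofGen w)) = e.toFun (ofGen (a :: w)))
    (hr : ∀ a : X, ∃ r : B ⟶ B, ∀ w, r.toFun (e.toFun (ofGen w)) = e.toFun (ofGen (w ++ [a]))) :
    ∃ (M : V.Mon) (q : V.freeMon X ⟶ M) (i : B ≅ M.toAlg), e ≫ i.hom = q.toHom := by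
  have hl' : ∀ u : List X, ∃ l : B ⟶ B, ∀ w,
      l.toFun (e.toFun (ofGen w)) = e.toFun (ofGen (u ++ w)) := by
    intro u
    induction u with
    | nil => exact ⟨𝟙 B, fun _ => rfl⟩
    | cons a u ih =>
      obtain ⟨l, hl₁⟩ := ih
      obtain ⟨k, hk⟩ := hl a
      exact ⟨l ≫ k, fun w => (congrArg k.toFun (hl₁ w)).trans (hk _)⟩
  -- The induction appends `u` letter by letter, so the part `w'` already appended has to vary.
  have hr' : ∀ u w' : List X, ∃ r : B ⟶ B, ∀ w,
      r.toFun (e.toFun (ofGen (w ++ w'))) = e.toFun (ofGen (w ++ (w' ++ u))) := by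
    intro u
    induction u with
    | nil => exact fun w' => ⟨𝟙 B, fun w => by simp⟩
    | cons a u ih =>
      intro w'
      obtain ⟨k, hk⟩ := hr a
      obtain ⟨r, hr₁⟩ := ih (w' ++ [a])
      refine ⟨k ≫ r, fun w => ?_⟩
      rw [Alg.comp_apply, hk, List.append_assoc, hr₁, List.append_assoc]
      rfl
  have left : ∀ x, ∃ l : B ⟶ B, ∀ y, l.toFun (e.toFun y) = e.toFun (freeMul x y) := by
    intro x
    induction x using free_induction with
    | gen u =>
      obtain ⟨l, hl₁⟩ := hl' u
      refine ⟨l, fun y => ?_⟩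
      induction y using free_induction with
      | gen w => rw [hl₁, freeMul_ofGen]
      | op σ y ih =>
        rw [e.isHom.map_funMap, l.isHom.map_funMap, (freeMul_isHom_left _).map_funMap,
          e.isHom.map_funMap]
        simp only [ih]
    | op σ x ih =>
      choose l hl₁ using ih
      -- By entropicity a pointwise operation on endomorphisms is again an endomorphism, so left
      -- multiplication by `funMap σ x` descends as soon as that by each `x i` does.
      refine ⟨Alg.homFunMap σ l, fun y => ?_⟩
      rw [(freeMul_isHom_right y).map_funMap, e.isHom.map_funMap]
      exact congrArg _ (funext fun i => hl₁ i y)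
  have right : ∀ y, ∃ r : B ⟶ B, ∀ x, r.toFun (e.toFun x) = e.toFun (freeMul x y) := by
    intro y
    induction y using free_induction with
    | gen u =>
      obtain ⟨r, hr₁⟩ := hr' u []
      refine ⟨r, fun x => ?_⟩
      induction x using free_induction with
      | gen w => rw [freeMul_ofGen]; simpa using hr₁ w
      | op σ x ih =>
        rw [e.isHom.map_funMap, r.isHom.map_funMap, (freeMul_isHom_right _).map_funMap,
          e.isHom.map_funMap]
        simp only [ih]
    | op σ y ih =>
      choose r hr₁ using ih
      refine ⟨Alg.homFunMap σ r, fun x => ?_⟩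
      rw [(freeMul_isHom_left x).map_funMap, e.isHom.map_funMap]
      exact congrArg _ (funext fun i => hr₁ i x)
  choose l hl₁ using left
  choose r hr₁ using right
  choose s hs using he
  -- The product is independent of the chosen preimages: the descended multiplications replace one
  -- factor at a time.
  have hmul : ∀ x y, e.toFun (freeMul (s (e.toFun x)) (s (e.toFun y))) = e.toFun (freeMul x y) := by
    intro x y
    rw [← hr₁, hs, hr₁, ← hl₁, hs, hl₁]
  let mul : B.carrier → B.carrier → B.carrier := fun a b => e.toFun (freeMul (s a) (s b))
  have hL : ∀ a, mul a = (l (s a)).toFun := fun a => funext fun b => by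
    change e.toFun _ = _
    rw [← hl₁, hs]
  have hR : ∀ b, (fun a => mul a b) = (r (s b)).toFun := fun b => funext fun a => by
    change e.toFun _ = _
    rw [← hr₁, hs]
  have hassoc : ∀ x y z : (V.free (List X)).carrier,
      freeMul (freeMul x y) z = freeMul x (freeMul y z) :=
    fun x y z => mul_assoc (G := (V.freeMon X).carrier) x y z
  let M : V.Mon :=
    { toAlg := B
      monoid :=
        { mul := mul
          one := e.toFun (ofGen [])
          one_mul := fun a => by
            have h := hmul (ofGen []) (s a)
            rw [hs] at h
            exact h.trans ((congrArg e.toFun (one_mul (M := (V.freeMon X).carrier) (s a))).trans (hs a))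
          mul_one := fun a => by
            have h := hmul (s a) (ofGen [])
            rw [hs] at h
            exact h.trans ((congrArg e.toFun (mul_one (M := (V.freeMon X).carrier) (s a))).trans (hs a))
          mul_assoc := fun a b c => by
            have h := hmul (freeMul (s a) (s b)) (s c)
            have h' := hmul (s a) (freeMul (s b) (s c))
            rw [hs] at h h'
            exact h.trans ((congrArg e.toFun (hassoc _ _ _)).trans h'.symm) }
      isHom_mul_left := fun a => by
        change B.IsHom B (mul a)
        rw [hL]
        exact (l (s a)).isHom
      isHom_mul_right := fun b => by
        change B.IsHom B (fun a => mul a b)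
        rw [hR]
        exact (r (s b)).isHom }
  exact ⟨M, { toHom := e, map_one := rfl, map_mul := fun x y => (hmul x y).symm }, Iso.refl B, rfl⟩

theorem GenMon.quot_append [V.IsEntropic] {X : Type u} (M : V.GenMon X) (u w : List X) :
    M.quot.toFun (ofGen (u ++ w)) = M.quot.toFun (ofGen u) * M.quot.toFun (ofGen w) :=
  (congrArg M.quot.toFun (freeMul_ofGen u w).symm).trans (M.quot.map_mul _ _)

end AlgVariety

namespace Predual

variable {C D : AlgVariety.{u}} [C.IsLocallyFinite] [D.IsLocallyFinite] (E : Predual C D)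

theorem rightDeriv_isHom {X : Type u} (a : X) :
    (E.languageAlg X).IsHom (E.languageAlg X) (rightDeriv a) :=
  ⟨fun _ _ h w => h (w ++ [a]), fun _ _ => rfl⟩

/-! ### Recognition of languages -/

theorem labelD_extend {X : Type u} (L : Language X) (w : List X) :
    E.labelD ((E.extend L).toFun (ofGen w)) = (w ∈ L) :=
  (congrArg E.labelD (lift_ofGen _ w)).trans (E.labelD.apply_symm_apply _)

theorem eq_extend_iff {X : Type u} {L : Language X} {f : D.free (List X) ⟶ E.outD.obj} :
    f = E.extend L ↔ ∀ w, E.labelD (f.toFun (ofGen w)) = (w ∈ L) :=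
  ⟨fun h w => h ▸ E.labelD_extend L w, fun h => free_hom_ext fun w =>
    E.labelD.injective ((h w).trans (E.labelD_extend L w).symm)⟩

/-- The languages recognized by a morphism from the free algebra on words: those whose extension
factors through it. -/
def recognized {X : Type u} {B : D.Alg} (q : D.free (List X) ⟶ B) : Set (Language X) :=
  {L | ∃ g : B ⟶ E.outD.obj, q ≫ g = E.extend L}

/-- The language recognized by a morphism into `O_D`. -/
def languageOf {X : Type u} (f : D.free (List X) ⟶ E.outD.obj) : Language X :=
  {w | E.labelD (f.toFun (ofGen w))}

theorem extend_languageOf {X : Type u} (f : D.free (List X) ⟶ E.outD.obj) :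
    f = E.extend (E.languageOf f) :=
  E.eq_extend_iff.2 fun _ => rfl

theorem languageOf_mem_recognized {X : Type u} {B : D.Alg} (q : D.free (List X) ⟶ B)
    (g : B ⟶ E.outD.obj) : E.languageOf (q ≫ g) ∈ E.recognized q :=
  ⟨g, E.extend_languageOf _⟩

theorem finite_recognized {X : Type u} {B : D.Alg} [Finite B.carrier]
    (q : D.free (List X) ⟶ B) : (E.recognized q).Finite := by
  have := E.outD.property
  have : Finite (B ⟶ E.outD.obj) :=
    Finite.of_injective (fun g => g.toFun) fun _ _ h => Alg.Hom.ext h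
  refine (Set.finite_range fun g : B ⟶ E.outD.obj => E.languageOf (q ≫ g)).subset ?_
  rintro L ⟨g, hg⟩
  exact ⟨g, Set.ext fun w => iff_of_eq (E.eq_extend_iff.1 hg w)⟩

/-- The operations of `C` on recognized languages are compatible with extension. -/
theorem labelD_extend_funMap {X : Type u} {B : D.Alg} [Finite B.carrier]
    (q : D.free (List X) ⟶ B) {n : ℕ} (σ : C.lang.Functions n)
    (L : Fin n → (E.languageAlg X).carrier) (hL : ∀ i, L i ∈ E.recognized q) :
    (funMap σ L : (E.languageAlg X).carrier) ∈ E.recognized q ∧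
      ∀ x, E.labelD ((E.extend (funMap σ L : (E.languageAlg X).carrier)).toFun x)
        = E.label (funMap σ fun i => E.label.symm (E.labelD ((E.extend (L i)).toFun x))) := by
  choose g hg using hL
  -- On languages the operations of `C` are defined at words only. Performing them on morphisms `B ⟶
  -- O_D` gives a `D`-morphism whose values are known on the whole of `Ψ X*`.
  obtain ⟨h, hh⟩ := E.exists_outD_funMap B σ g
  have key : q ≫ h = E.extend (funMap σ L : (E.languageAlg X).carrier) := by
    refine E.eq_extend_iff.2 fun w => (hh _).trans ?_
    refine congrArg E.label (congrArg _ (funext fun i => congrArg _ ?_))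
    exact E.eq_extend_iff.1 (hg i) w
  refine ⟨⟨h, key⟩, fun x => ?_⟩
  rw [← key, Alg.comp_apply, hh]
  simp only [← hg, Alg.comp_apply]

variable {E}

/-- Two morphisms `S W ⟶ O_D` are pairings with languages `K` and `L` in `W`. If they agree on the
image of `e_{SW}`, in particular on words, then `K = L` by `pair_dualWord`; so the inclusion of the
image can be cancelled against `O_D`. -/
theorem LocalVariety.dualMap_surjective (hepi : D.EpisSurjective) {X : Type u}
    (W : E.LocalVariety X) (hW : W.langs.Finite) : Function.Surjective (W.dualMap hW).toFun := by
  have := (W.dual hW).property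
  have key : Function.Surjective (Alg.rangeIncl (W.dualMap hW)).toFun := by
    refine surjective_of_cancel_outD (E := E) hepi _ fun g h hgh => ?_
    obtain ⟨K, hK⟩ := E.exists_pair_eq (A := W.fin hW) g
    obtain ⟨L, hL⟩ := E.exists_pair_eq (A := W.fin hW) h
    have hKL : K = L := Subtype.ext (Set.ext fun w => iff_of_eq (by
      refine (W.pair_dualWord hW w K).symm.trans (Eq.trans ?_ (W.pair_dualWord hW w L))
      refine (hK _).symm.trans (Eq.trans ?_ (hL _))
      exact congrArg E.labelD (Alg.congr_toFun hgh ⟨_, ofGen w, lift_ofGen _ w⟩)))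
    exact Alg.hom_ext fun x => E.labelD.injective ((hK x).trans (hKL ▸ (hL x).symm))
  intro x
  obtain ⟨⟨_, t, rfl⟩, rfl⟩ := key x
  exact ⟨t, rfl⟩

/-! ### The correspondence of finite local varieties and finite generated monoids -/

variable (E)

section

variable [D.IsEntropic]

/-- The local variety of the languages recognized by a finite generated monoid. -/
def localVariety {X : Type u} (M : D.GenMon X) : E.LocalVariety X where
  langs := E.recognized (show D.free (List X) ⟶ M.mon.toAlg from M.quot.toHom)
  regular := by
    rintro L ⟨g, hg⟩
    have := M.finite
    -- The left quotient by `x` depends only on the value of `x` in the finite monoid `M`.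
    refine Language.IsRegular.of_finite_range_leftQuotient ((Set.finite_range
      fun m => ({w | E.labelD (g.toFun (m * M.quot.toFun (ofGen w)))} : Language X)).subset ?_)
    rintro _ ⟨x, rfl⟩
    refine ⟨M.quot.toFun (ofGen x), Set.ext fun w => iff_of_eq ?_⟩
    change E.labelD (g.toFun (_ * _)) = (x ++ w ∈ L)
    rw [← M.quot_append]
    exact E.eq_extend_iff.1 hg (x ++ w)
  funMap_mem σ L hL := by
    have := M.finite
    exact (E.labelD_extend_funMap _ σ L hL).1
  leftDeriv_mem := by
    rintro L ⟨g, hg⟩ a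
    refine ⟨(⟨_, M.mon.isHom_mul_left (M.quot.toFun (ofGen [a]))⟩ : M.mon.toAlg ⟶ M.mon.toAlg) ≫ g,
      E.eq_extend_iff.2 fun w => ?_⟩
    refine Eq.trans ?_ (E.eq_extend_iff.1 hg ([a] ++ w))
    exact congrArg (fun m => E.labelD (g.toFun m)) (M.quot_append [a] w).symm
  rightDeriv_mem := by
    rintro L ⟨g, hg⟩ a
    refine ⟨(⟨_, M.mon.isHom_mul_right (M.quot.toFun (ofGen [a]))⟩ : M.mon.toAlg ⟶ M.mon.toAlg) ≫ g,
      E.eq_extend_iff.2 fun w => ?_⟩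
    refine Eq.trans ?_ (E.eq_extend_iff.1 hg (w ++ [a]))
    exact congrArg (fun m => E.labelD (g.toFun m)) (M.quot_append w [a]).symm

theorem finite_localVariety {X : Type u} (M : D.GenMon X) : (E.localVariety M).langs.Finite :=
  have := M.finite
  E.finite_recognized _

theorem localVariety_mono {X : Type u} {M N : D.GenMon X} (k : N.mon ⟶ M.mon)
    (hk : N.quot ≫ k = M.quot) : (E.localVariety M).langs ⊆ (E.localVariety N).langs := by
  rintro L ⟨g, hg⟩
  refine ⟨(show N.mon.toAlg ⟶ M.mon.toAlg from k.toHom) ≫ g, ?_⟩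
  rw [← hg, ← hk]
  rfl

variable {E}

/-- Every composite of `M.quot` with a morphism into `O_D` is the extension of a recognized
language, so the inclusion is the hypothesis of `exists_factor`. The factor is multiplicative
because `N.quot` is surjective. -/
theorem exists_genMon_hom (hC : ¬ C.ordered) {X : Type u} {M N : D.GenMon X}
    (h : (E.localVariety M).langs ⊆ (E.localVariety N).langs) :
    ∃ k : N.mon ⟶ M.mon, N.quot ≫ k = M.quot := by
  have := M.finite
  have := N.finite
  obtain ⟨k, hk⟩ := exists_factor (E := E) hC
    (show D.free (List X) ⟶ N.mon.toAlg from N.quot.toHom) N.surjective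
    (show D.free (List X) ⟶ M.mon.toAlg from M.quot.toHom) fun g => by
      obtain ⟨g', hg'⟩ := h (E.languageOf_mem_recognized _ g)
      exact ⟨g', hg'.trans (E.extend_languageOf _).symm⟩
  obtain ⟨k', hk', -⟩ := Mon.exists_desc N.quot N.surjective M.quot k (Alg.congr_toFun hk)
  exact ⟨k', hk'⟩

/-- Along `i`, the morphisms from `M` to `O_D` are the pairings with languages in `W`, and pairing
with `L` takes the value `[w ∈ L]` at the image of a word `w`. -/
theorem LocalVariety.Corresponds.eq_localVariety {X : Type u} {W : E.LocalVariety X}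
    {M : D.GenMon X} (h : W.Corresponds M) : W = E.localVariety M := by
  obtain ⟨hW, i, hi⟩ := h
  have hq : ∀ w, M.quot.toFun (ofGen w) = i.hom.toFun (W.dualWord hW w) := fun w =>
    (Alg.congr_toFun hi (ofGen w)).symm.trans (congrArg i.hom.toFun (lift_ofGen _ w))
  refine LocalVariety.ext (Set.ext fun L => ⟨fun hL => ?_, ?_⟩)
  · refine ⟨i.inv ≫ (E.toOutD (W.fin hW) ⟨L, hL⟩).hom, E.eq_extend_iff.2 fun w => ?_⟩
    refine Eq.trans ?_ (W.pair_dualWord hW w ⟨L, hL⟩)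
    change E.labelD (Alg.Hom.toFun _ (i.inv.toFun (M.quot.toFun (ofGen w)))) = _
    rw [hq, Alg.iso_hom_inv]
    rfl
  · rintro ⟨g, hg⟩
    obtain ⟨⟨K, hK⟩, ha⟩ := E.exists_pair_eq (A := W.fin hW) (i.hom ≫ g)
    suffices h : K = L from h ▸ hK
    refine Set.ext fun w => iff_of_eq ?_
    refine (W.pair_dualWord hW w ⟨K, hK⟩).symm.trans ((ha _).symm.trans ?_)
    refine Eq.trans ?_ (E.eq_extend_iff.1 hg w)
    exact congrArg (fun m => E.labelD (g.toFun m)) (hq w).symm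

/-- Every finite local variety corresponds to a finite generated monoid. -/
theorem LocalVariety.exists_corresponds (hepi : D.EpisSurjective) {X : Type u}
    (W : E.LocalVariety X) (hW : W.langs.Finite) : ∃ M : D.GenMon X, W.Corresponds M := by
  have hgen : ∀ w, (W.dualMap hW).toFun (ofGen w) = W.dualWord hW w := fun w => lift_ofGen _ w
  obtain ⟨M, q, i, hi⟩ := exists_monoid (W.dualMap hW) (W.dualMap_surjective hepi hW)
    (fun a => ⟨(W.dualNext hW a).hom, fun w => by rw [hgen, hgen]; rfl⟩)
    (fun a => by
      -- The right derivative is a `C`-endomorphism of `W`; its dual sends `e_{SW} w` to `e_{SW} (w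
      -- ++ [a])`, as pairing with all `L` shows.
      let ρ : W.fin hW ⟶ W.fin hW := ObjectProperty.homMk
        ⟨fun L => ⟨rightDeriv a L.1, W.rightDeriv_mem L.1 L.2 a⟩,
          fun _ _ h => (E.rightDeriv_isHom a).monotone h, fun _ _ => rfl⟩
      refine ⟨(E.dualHom ρ).hom, fun w => ?_⟩
      rw [hgen, hgen]
      refine E.pair_right_injective fun L => ?_
      refine (E.pair_dualHom ρ L _).trans ?_
      exact (W.pair_dualWord hW w _).trans (W.pair_dualWord hW (w ++ [a]) L).symm)
  have := (W.dual hW).property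
  refine ⟨⟨M, Finite.of_injective i.inv.toFun (Alg.bijective_of_isIso i.inv).1, q, fun m => ?_⟩,
    hW, i, hi⟩
  obtain ⟨x, rfl⟩ := (Alg.bijective_of_isIso i.hom).2 m
  obtain ⟨t, rfl⟩ := W.dualMap_surjective hepi hW x
  exact ⟨t, (Alg.congr_toFun hi t).symm⟩

/-- A finite generated monoid corresponds precisely to the local variety of the languages it
recognizes. -/
theorem LocalVariety.corresponds_iff (hC : ¬ C.ordered) (hepi : D.EpisSurjective) {X : Type u}
    {W : E.LocalVariety X} {M : D.GenMon X} : W.Corresponds M ↔ W = E.localVariety M := by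
  refine ⟨Corresponds.eq_localVariety, ?_⟩
  rintro rfl
  -- The monoid `N` recognizes the same languages as `M`. Each is thus a quotient of the other
  -- compatibly with the maps from `Ψ X*`, and these being onto makes the comparison maps mutually
  -- inverse.
  obtain ⟨N, hN⟩ := (E.localVariety M).exists_corresponds hepi (E.finite_localVariety M)
  have h := hN.eq_localVariety
  obtain ⟨hW, i, hi⟩ := hN
  obtain ⟨k, hk⟩ := exists_genMon_hom (E := E) hC (M := M) (N := N) (h ▸ subset_rfl)
  obtain ⟨l, hl⟩ := exists_genMon_hom (E := E) hC (M := N) (N := M) (h ▸ subset_rfl)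
  have hkl : ∀ x, l.toFun (k.toFun x) = x := fun x => by
    obtain ⟨t, rfl⟩ := N.surjective x
    exact (congrArg l.toFun (Mon.congr_toFun hk t)).trans
      (Mon.congr_toFun hl t)
  have hlk : ∀ x, k.toFun (l.toFun x) = x := fun x => by
    obtain ⟨t, rfl⟩ := M.surjective x
    exact (congrArg k.toFun (Mon.congr_toFun hl t)).trans
      (Mon.congr_toFun hk t)
  let j : N.mon.toAlg ≅ M.mon.toAlg :=
    ⟨k.toHom, l.toHom, Alg.hom_ext hkl, Alg.hom_ext hlk⟩
  refine ⟨hW, i ≪≫ j, Alg.hom_ext fun t => ?_⟩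
  refine (congrArg k.toFun (Alg.congr_toFun hi t)).trans ?_
  exact Mon.congr_toFun hk t

theorem LocalVariety.exists_eq_localVariety (hepi : D.EpisSurjective) {X : Type u}
    (W : E.LocalVariety X) (hW : W.langs.Finite) :
    ∃ M : D.GenMon X, W = E.localVariety M :=
  (W.exists_corresponds hepi hW).imp fun _ h => h.eq_localVariety

theorem LocalVariety.mem_genMons (hC : ¬ C.ordered) (hepi : D.EpisSurjective) {X : Type u}
    {V : E.LocalVariety X} {M : D.GenMon X} :
    M ∈ V.genMons ↔ (E.localVariety M).langs ⊆ V.langs := by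
  constructor
  · rintro ⟨W, hW, h⟩
    rwa [← h.eq_localVariety]
  · exact fun h => ⟨_, h, (corresponds_iff hC hepi).2 rfl⟩

end

/-! ### Local varieties are directed unions of finite ones -/

variable {E}

/-- The set of all two-sided quotients of a regular language is finite. -/
theorem finite_range_quotients {X : Type u} {L : Language X} (hL : L.IsRegular) :
    (Set.range fun p : List X × List X => ({w | p.1 ++ w ++ p.2 ∈ L} : Language X)).Finite := by
  obtain ⟨S, _, M, rfl⟩ := hL
  -- The quotient by `(x, y)` depends only on the state reached by `x` and on the set of states from
  -- which `y` is accepted.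
  refine (Set.finite_range fun p : S × Set S =>
    ({w | M.evalFrom p.1 w ∈ p.2} : Language X)).subset ?_
  rintro _ ⟨⟨x, y⟩, rfl⟩
  refine ⟨(M.eval x, {s | M.evalFrom s y ∈ M.accept}), Set.ext fun w => ?_⟩
  change M.evalFrom (M.evalFrom (M.eval x) w) y ∈ M.accept ↔ M.eval (x ++ w ++ y) ∈ M.accept
  change _ ↔ M.evalFrom M.start (x ++ w ++ y) ∈ M.accept
  rw [DFA.evalFrom_of_append, DFA.evalFrom_of_append]
  rfl

/-- A finite subset of a local variety is contained in a finite local subvariety. -/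
theorem LocalVariety.exists_finite {X : Type u} (V : E.LocalVariety X)
    {F : Set (Language X)} (hF : F.Finite) (hFV : F ⊆ V.langs) :
    ∃ W : E.LocalVariety X, W.langs.Finite ∧ F ⊆ W.langs ∧ W.langs ⊆ V.langs := by
  have hleft : ∀ (x : List X) (L : Language X), L ∈ V.langs →
      ({w | x ++ w ∈ L} : Language X) ∈ V.langs := by
    intro x
    induction x with
    | nil => exact fun L hL => hL
    | cons a x ih => exact fun L hL => ih _ (V.leftDeriv_mem L hL a)
  have hright : ∀ (y : List X) (L : Language X), L ∈ V.langs →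
      ({w | w ++ y ∈ L} : Language X) ∈ V.langs := by
    intro y
    induction y using List.reverseRecOn with
    | nil =>
      intro L hL
      have h : ({w | w ++ [] ∈ L} : Language X) = L := Set.ext fun w => by
        change w ++ [] ∈ L ↔ w ∈ L
        rw [List.append_nil]
      rwa [h]
    | append_singleton y a ih =>
      intro L hL
      have h := ih _ (V.rightDeriv_mem L hL a)
      simp only [rightDeriv] at h
      convert h using 1
      exact Set.ext fun w => by
        change w ++ (y ++ [a]) ∈ L ↔ (w ++ y) ++ [a] ∈ L
        rw [List.append_assoc]
  -- All two-sided quotients of members of `F`: a finite set closed under both derivatives. The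
  -- subalgebra it generates is finite by local finiteness, and closed under derivatives because
  -- these are `C`-morphisms.
  let T : Set (Language X) := ⋃ L ∈ F, Set.range
    fun p : List X × List X => ({w | p.1 ++ w ++ p.2 ∈ L} : Language X)
  have hT : T.Finite := hF.biUnion fun L hL => finite_range_quotients (V.regular L (hFV hL))
  have hTV : T ⊆ V.langs := by
    refine Set.iUnion₂_subset fun L hL => ?_
    rintro _ ⟨⟨x, y⟩, rfl⟩
    exact hleft x _ (hright y L (hFV hL))
  have hTl : ∀ K ∈ T, ∀ a, leftDeriv a K ∈ T := by
    intro K hK a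
    obtain ⟨L, hL, ⟨x, y⟩, rfl⟩ := Set.mem_iUnion₂.1 hK
    refine Set.mem_iUnion₂.2 ⟨L, hL, ⟨x ++ [a], y⟩, Set.ext fun w => ?_⟩
    change x ++ [a] ++ w ++ y ∈ L ↔ x ++ (a :: w) ++ y ∈ L
    simp
  have hTr : ∀ K ∈ T, ∀ a, rightDeriv a K ∈ T := by
    intro K hK a
    obtain ⟨L, hL, ⟨x, y⟩, rfl⟩ := Set.mem_iUnion₂.1 hK
    refine Set.mem_iUnion₂.2 ⟨L, hL, ⟨x, a :: y⟩, Set.ext fun w => ?_⟩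
    change x ++ w ++ (a :: y) ∈ L ↔ x ++ (w ++ [a]) ++ y ∈ L
    simp
  have := hT.to_subtype
  have : Finite (C.free T).carrier := IsLocallyFinite.finite_free _
  let φ : C.free T ⟶ E.languageAlg X := lift fun K => K.1
  have hgen : ∀ K, φ.toFun (ofGen K) = K.1 := fun K => lift_ofGen _ K
  have hφV : ∀ k, φ.toFun k ∈ V.langs := by
    intro k
    induction k using free_induction with
    | gen K => rw [hgen]; exact hTV K.2
    | op σ k ih => rw [φ.isHom.map_funMap]; exact V.funMap_mem σ _ ih
  have hclosed : ∀ (d : Language X → Language X), (E.languageAlg X).IsHom (E.languageAlg X) d →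
      (∀ K ∈ T, d K ∈ T) → ∀ L ∈ Set.range φ.toFun, d L ∈ Set.range φ.toFun := by
    rintro d hd hdT _ ⟨k, rfl⟩
    induction k using free_induction with
    | gen K => exact ⟨ofGen ⟨d K.1, hdT K.1 K.2⟩, by rw [hgen, hgen]⟩
    | op σ k ih =>
      rw [φ.isHom.map_funMap, hd.map_funMap]
      exact Alg.funMap_mem_range φ σ _ ih
  refine ⟨⟨Set.range φ.toFun, ?_, Alg.funMap_mem_range φ,
    fun L hL a => hclosed _ (E.leftDeriv_isHom a) (fun K hK => hTl K hK a) L hL,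
    fun L hL a => hclosed _ (E.rightDeriv_isHom a) (fun K hK => hTr K hK a) L hL⟩,
    Set.finite_range _, fun L hL => ⟨ofGen ⟨L, ?_⟩, hgen _⟩, ?_⟩
  · rintro _ ⟨k, rfl⟩
    exact V.regular _ (hφV k)
  · exact Set.mem_iUnion₂.2 ⟨L, hL, ⟨[], []⟩, Set.ext fun w => by
      change [] ++ w ++ [] ∈ L ↔ w ∈ L
      rw [List.nil_append, List.append_nil]⟩
  · rintro _ ⟨k, rfl⟩
    exact hφV k

end Predual

namespace Predual

variable {C D : AlgVariety.{u}} [C.IsLocallyFinite] [D.IsLocallyFinite] {E : Predual C D}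

/-- A global section lies over the identity only up to equality of objects, so its values have to be
compared along casts. -/
theorem FLang.eq_of_cast_eq {A B : E.FLang} {X : D.FreeMon} (hA : A.base = X) (hB : B.base = X)
    (h : cast (congrArg (fun Y : D.FreeMon => E.LocalVariety Y.alphabet) hA) A.lang
      = cast (congrArg (fun Y : D.FreeMon => E.LocalVariety Y.alphabet) hB) B.lang) : A = B := by
  obtain ⟨A, V⟩ := A
  obtain ⟨B, W⟩ := B
  obtain rfl : A = X := hA
  obtain rfl : B = A := hB
  exact congrArg (FLang.mk B) h

variable [D.IsEntropic]

/-! ### Varieties of languages as closed families of local varieties -/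

theorem LocalVariety.ClosedUnderPreimages.preimage_mem {X Y : Type u} {V : E.LocalVariety X}
    {f : D.freeMon X ⟶ D.freeMon Y} {W : E.LocalVariety Y} (h : V.ClosedUnderPreimages f W)
    {L : Language Y} (hL : L ∈ W.langs) : E.preimage f L ∈ V.langs := by
  obtain ⟨h, hh⟩ := h
  exact hh ⟨L, hL⟩ ▸ (h.toFun ⟨L, hL⟩).2

theorem FLang.closedUnderPreimages_cast {A B : E.FLang} {X Y : D.FreeMon} (hA : A.base = X)
    (hB : B.base = Y) (φ : A ⟶ B) (f : X ⟶ Y)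
    (hf : FLang.Hom.hom φ = eqToHom hA ≫ f ≫ eqToHom hB.symm) :
    LocalVariety.ClosedUnderPreimages
      (cast (congrArg (fun Y : D.FreeMon => E.LocalVariety Y.alphabet) hA) A.lang) f
      (cast (congrArg (fun Y : D.FreeMon => E.LocalVariety Y.alphabet) hB) B.lang) := by
  subst hA hB
  simp only [eqToHom_refl, Category.comp_id, Category.id_comp] at hf
  exact hf ▸ φ.closed

namespace VarietyOfLanguages

theorem closedUnderPreimages (𝒱 : E.VarietyOfLanguages) {X Y : D.FreeMon} (f : X ⟶ Y) :
    (VarietyOfLanguages.at 𝒱 X).ClosedUnderPreimages f (VarietyOfLanguages.at 𝒱 Y) :=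
  FLang.closedUnderPreimages_cast (Functor.congr_obj 𝒱.comp_eq X)
    (Functor.congr_obj 𝒱.comp_eq Y) (𝒱.functor.map f) f (Functor.congr_hom 𝒱.comp_eq f)

/-- The projection `p` is faithful: a morphism over the base carries no further data. A section is
thus determined by its values on objects. -/
theorem ext {𝒱 𝒲 : E.VarietyOfLanguages}
    (h : ∀ X, VarietyOfLanguages.at 𝒱 X = VarietyOfLanguages.at 𝒲 X) : 𝒱 = 𝒲 := by
  obtain ⟨F, hF⟩ := 𝒱
  obtain ⟨G, hG⟩ := 𝒲
  have hobj : ∀ X, F.obj X = G.obj X := fun X =>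
    FLang.eq_of_cast_eq (Functor.congr_obj hF X) (Functor.congr_obj hG X) (h X)
  have : F = G := by
    refine CategoryTheory.Functor.ext hobj fun X Y f => FLang.Hom.ext ?_
    change E.p.map (F.map f) = E.p.map (eqToHom _ ≫ G.map f ≫ eqToHom _)
    rw [Functor.map_comp, Functor.map_comp, eqToHom_map, eqToHom_map]
    have hFf := Functor.congr_hom hF f
    have hGf := Functor.congr_hom hG f
    rw [Functor.comp_map] at hFf hGf
    rw [hFf, hGf]
    simp
  subst this
  rfl

/-- A family of local varieties closed under preimages is a variety of languages. -/
noncomputable def ofFamily (V : ∀ X : D.FreeMon, E.LocalVariety X.alphabet)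
    (h : ∀ {X Y : D.FreeMon} (f : X ⟶ Y), (V X).ClosedUnderPreimages f (V Y)) :
    E.VarietyOfLanguages where
  functor :=
    { obj := fun X => ⟨X, V X⟩
      map := fun f => ⟨f, h f⟩
      map_id := fun _ => rfl
      map_comp := fun _ _ => rfl }
  comp_eq := rfl

end VarietyOfLanguages

/-! ### From varieties of languages to pseudovarieties -/

/-- Finitely many monoids corresponding to local subvarieties of `V` are quotients of a single
one. -/
theorem LocalVariety.exists_genMon_cover (hC : ¬ C.ordered) (hepi : D.EpisSurjective) {X : Type u}
    (V : E.LocalVariety X) {ι : Type u} [Finite ι] (N : ι → D.GenMon X)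
    (hN : ∀ i, N i ∈ V.genMons) :
    ∃ K ∈ V.genMons, ∀ i, ∃ k : K.mon ⟶ (N i).mon, K.quot ≫ k = (N i).quot := by
  obtain ⟨W, hW, hsub, hWV⟩ := V.exists_finite
    (F := ⋃ i, (E.localVariety (N i)).langs)
    (Set.finite_iUnion fun i => E.finite_localVariety (N i))
    (Set.iUnion_subset fun i => (mem_genMons hC hepi).1 (hN i))
  obtain ⟨K, rfl⟩ := W.exists_eq_localVariety hepi hW
  exact ⟨K, (mem_genMons hC hepi).2 hWV, fun i =>
    exists_genMon_hom hC ((Set.subset_iUnion _ i).trans hsub)⟩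

/-- The pseudovariety of the finite monoids recognizing only languages of a given family of local
varieties. -/
def pseudovarietyOf (hC : ¬ C.ordered) (hepi : D.EpisSurjective)
    (V : ∀ X : D.FreeMon, E.LocalVariety X.alphabet) : D.Pseudovariety where
  mons := {M | Finite M.carrier ∧ ∀ (X : D.FreeMon) (f : X.mon ⟶ M),
    ∃ N ∈ (V X).genMons, ∃ g : N.mon ⟶ M, N.quot ≫ g = f}
  finite _ hM := hM.1
  sub_mem := by
    rintro M N f hf hr ⟨_, hM⟩
    refine ⟨Finite.of_injective f.toFun hf, fun X g => ?_⟩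
    obtain ⟨K, hK, k, hk⟩ := hM X (g ≫ f)
    obtain ⟨l, hl⟩ := Mon.exists_lift f hf hr k fun x => by
      obtain ⟨t, rfl⟩ := K.surjective x
      exact ⟨g.toFun t, (Mon.congr_toFun hk t).symm⟩
    refine ⟨K, hK, l, Mon.hom_ext fun t => hf ?_⟩
    exact (Mon.congr_toFun hl _).trans (Mon.congr_toFun hk t)
  quot_mem := by
    rintro M N q hq ⟨_, hM⟩
    refine ⟨Finite.of_surjective q.toFun hq, fun X f => ?_⟩
    obtain ⟨g, hg⟩ := freeMon_projective q hq f
    obtain ⟨K, hK, k, hk⟩ := hM X g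
    exact ⟨K, hK, k ≫ q, by rw [← Category.assoc, hk]; exact hg⟩
  pi_mem := by
    intro ι _ M hM
    refine ⟨Mon.finite_pi M fun i => (hM i).1, fun X f => ?_⟩
    choose N hN g hg using fun i => (hM i).2 X (f ≫ Mon.piProj M i)
    -- The components of `f` factor through different generated monoids; a common cover `K` lets the
    -- factors be assembled into the product.
    obtain ⟨K, hK, hk⟩ := (V X).exists_genMon_cover hC hepi N hN
    choose k hk using hk
    refine ⟨K, hK, Mon.piLift fun i => k i ≫ g i, Mon.hom_ext fun t => funext fun i => ?_⟩
    refine (congrArg (g i).toFun (Mon.congr_toFun (hk i) t)).trans ?_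
    exact Mon.congr_toFun (hg i) t

/-! ### From pseudovarieties to varieties of languages -/

variable (E)

/-- Take for `K` the image of `Ψ X*` in the product of the `M i`: a submonoid of a product, hence in
`𝒬`, and it projects to every `M i` compatibly with the generators. -/
theorem exists_localVariety_cover (𝒬 : D.Pseudovariety) {X : Type u} {ι : Type u} [Finite ι]
    (M : ι → D.GenMon X) (hM : ∀ i, (M i).mon ∈ 𝒬.mons) :
    ∃ K : D.GenMon X, K.mon ∈ 𝒬.mons ∧
      ∀ i, (E.localVariety (M i)).langs ⊆ (E.localVariety K).langs := by
  have := Mon.finite_pi (fun i => (M i).mon) fun i => (M i).finite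
  let f : D.freeMon X ⟶ Mon.pi fun i => (M i).mon := Mon.piLift fun i => (M i).quot
  exact ⟨GenMon.ofHom f, 𝒬.range_mem f (𝒬.pi_mem _ hM), fun i =>
    E.localVariety_mono (Mon.rangeIncl f ≫ Mon.piProj _ i) rfl⟩

/-- The languages recognized by the monoids of a pseudovariety. -/
def recognizedBy (𝒬 : D.Pseudovariety) (X : Type u) : E.LocalVariety X where
  langs := {L | ∃ M : D.GenMon X, M.mon ∈ 𝒬.mons ∧ L ∈ (E.localVariety M).langs}
  regular := by
    rintro L ⟨M, -, hL⟩
    exact (E.localVariety M).regular L hL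
  funMap_mem := by
    intro n σ L hL
    choose M hM hL using hL
    obtain ⟨K, hK, hsub⟩ := E.exists_localVariety_cover 𝒬 (ι := ULift (Fin n))
      (fun i => M i.down) fun i => hM i.down
    exact ⟨K, hK, (E.localVariety K).funMap_mem σ L fun i => hsub ⟨i⟩ (hL i)⟩
  leftDeriv_mem := by
    rintro L ⟨M, hM, hL⟩ a
    exact ⟨M, hM, (E.localVariety M).leftDeriv_mem L hL a⟩
  rightDeriv_mem := by
    rintro L ⟨M, hM, hL⟩ a
    exact ⟨M, hM, (E.localVariety M).rightDeriv_mem L hL a⟩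

theorem exists_recognizedBy_cover (𝒬 : D.Pseudovariety) {X : Type u} {ι : Type u} [Finite ι]
    (L : ι → Language X) (hL : ∀ i, L i ∈ (E.recognizedBy 𝒬 X).langs) :
    ∃ K : D.GenMon X, K.mon ∈ 𝒬.mons ∧ ∀ i, L i ∈ (E.localVariety K).langs := by
  choose M hM hL using hL
  obtain ⟨K, hK, hsub⟩ := E.exists_localVariety_cover 𝒬 M hM
  exact ⟨K, hK, fun i => hsub i (hL i)⟩

/-- If `M` recognizes `L`, then the image of `f ≫ M.quot`, a submonoid of `M`, recognizes the
preimage. -/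
theorem preimage_mem_recognizedBy (𝒬 : D.Pseudovariety) {X Y : Type u}
    (f : D.freeMon X ⟶ D.freeMon Y) {L : Language Y} (hL : L ∈ (E.recognizedBy 𝒬 Y).langs) :
    E.preimage f L ∈ (E.recognizedBy 𝒬 X).langs := by
  obtain ⟨M, hM, g, hg⟩ := hL
  have := M.finite
  let k : D.freeMon X ⟶ M.mon := f ≫ M.quot
  refine ⟨GenMon.ofHom k, 𝒬.range_mem k hM, Alg.rangeIncl k.toHom ≫ g, ?_⟩
  rw [extend_preimage, ← hg]
  rfl

/-- It remains that preimages commute with the operations of `C`. Since `f` may send a word to an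
arbitrary element of `Ψ Y*`, the pointwise definition on words is not enough; one monoid of `𝒬`
recognizing all arguments makes `labelD_extend_funMap` applicable. -/
theorem recognizedBy_closedUnderPreimages (hC : ¬ C.ordered) (𝒬 : D.Pseudovariety) {X Y : Type u}
    (f : D.freeMon X ⟶ D.freeMon Y) :
    (E.recognizedBy 𝒬 X).ClosedUnderPreimages f (E.recognizedBy 𝒬 Y) := by
  refine ⟨⟨fun L => ⟨E.preimage f L.1, E.preimage_mem_recognizedBy 𝒬 f L.2⟩,
    fun L K h => ?_, fun {n} σ L => Subtype.ext (Set.ext fun w => iff_of_eq ?_)⟩, fun _ => rfl⟩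
  · obtain rfl : L = K := (E.recognizedBy 𝒬 Y).automaton.states.discrete hC L K h
    exact le_refl _
  · obtain ⟨M, hM, hL⟩ := E.exists_recognizedBy_cover 𝒬 (ι := ULift (Fin n))
      (fun i => (L i.down).1) fun i => (L i.down).2
    have := M.finite
    exact (E.labelD_extend_funMap (show D.free (List Y) ⟶ M.mon.toAlg from M.quot.toHom) σ
      (fun i => (L i).1) fun i => hL ⟨i⟩).2 _

/-- The variety of the languages recognized by the monoids of a pseudovariety. -/
noncomputable def varietyOf (hC : ¬ C.ordered) (𝒬 : D.Pseudovariety) : E.VarietyOfLanguages :=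
  VarietyOfLanguages.ofFamily (fun X => E.recognizedBy 𝒬 X.alphabet)
    fun f => E.recognizedBy_closedUnderPreimages hC 𝒬 f

variable {E}

theorem recognizedBy_mono {𝒬 𝒬' : D.Pseudovariety} (h : 𝒬.mons ⊆ 𝒬'.mons) (X : Type u) :
    (E.recognizedBy 𝒬 X).langs ⊆ (E.recognizedBy 𝒬' X).langs :=
  fun _ ⟨M, hM, hL⟩ => ⟨M, h hM, hL⟩

theorem pseudovarietyOf_mono (hC : ¬ C.ordered) (hepi : D.EpisSurjective)
    {V W : ∀ X : D.FreeMon, E.LocalVariety X.alphabet} (h : ∀ X, (V X).langs ⊆ (W X).langs) :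
    (pseudovarietyOf hC hepi V).mons ⊆ (pseudovarietyOf hC hepi W).mons := by
  rintro M ⟨hfin, hM⟩
  refine ⟨hfin, fun X f => ?_⟩
  obtain ⟨N, ⟨U, hU, hN⟩, hg⟩ := hM X f
  exact ⟨N, ⟨U, hU.trans (h X), hN⟩, hg⟩

/-- Every pseudovariety is determined by the languages that its monoids recognize. -/
theorem pseudovarietyOf_recognizedBy (hC : ¬ C.ordered) (hepi : D.EpisSurjective)
    (𝒬 : D.Pseudovariety) :
    pseudovarietyOf hC hepi (fun X => E.recognizedBy 𝒬 X.alphabet) = 𝒬 := by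
  refine Pseudovariety.ext (Set.ext fun M => ⟨?_, fun hM => ⟨𝒬.finite M hM, fun X f => ?_⟩⟩)
  · rintro ⟨hfin, hM⟩
    -- With `M` as its own alphabet the canonical `f` is onto, so factoring it through `N` exhibits
    -- `M` as a quotient of `N`.
    let X : D.FreeMon := ⟨M.carrier⟩
    obtain ⟨f, hf, -⟩ := freeMon_existsUnique M (id : X.alphabet → M.carrier)
    obtain ⟨N, hN, g, hg⟩ := hM X f
    -- The finitely many languages of `N` are all recognized by a single `K` in `𝒬`, of which `N`,
    -- and therefore `M`, is a quotient.
    have := (E.finite_localVariety N).to_subtype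
    obtain ⟨K, hK, hL⟩ := E.exists_recognizedBy_cover 𝒬
      (fun L : (E.localVariety N).langs => L.1)
      fun L => (LocalVariety.mem_genMons hC hepi).1 hN L.2
    obtain ⟨k, hk⟩ := exists_genMon_hom (E := E) hC (M := N) (N := K) fun L h => hL ⟨L, h⟩
    refine 𝒬.quot_mem (k ≫ g) (fun m => ⟨K.quot.toFun (ofGen [m]), ?_⟩) hK
    refine (congrArg g.toFun (Mon.congr_toFun hk _)).trans ?_
    exact (Mon.congr_toFun hg _).trans (hf m)
  · have := 𝒬.finite M hM
    exact ⟨GenMon.ofHom f, (LocalVariety.mem_genMons hC hepi).2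
      fun L hL => ⟨_, 𝒬.range_mem f hM, hL⟩, Mon.rangeIncl f, rfl⟩

/-- A monoid corresponding to a local subvariety of a variety of languages lies in the associated
pseudovariety. -/
theorem VarietyOfLanguages.mem_pseudovarietyOf (hC : ¬ C.ordered) (hepi : D.EpisSurjective)
    (𝒱 : E.VarietyOfLanguages) {X : D.FreeMon} {M : D.GenMon X.alphabet}
    (hM : M ∈ (VarietyOfLanguages.at 𝒱 X).genMons) :
    M.mon ∈ (pseudovarietyOf hC hepi (VarietyOfLanguages.at 𝒱)).mons := by
  have := M.finite
  refine ⟨M.finite, fun Y f => ?_⟩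
  obtain ⟨g, hg⟩ := freeMon_projective M.quot M.surjective f
  refine ⟨GenMon.ofHom f, (LocalVariety.mem_genMons hC hepi).2 ?_, Mon.rangeIncl f, rfl⟩
  rintro L ⟨k, hk⟩
  have : Finite (Alg.range f.toHom).carrier := Mon.finite_range f
  -- The morphism `k` recognizing `L` is defined only on the image of `f`. Its extension `h` to `M`
  -- recognizes a language over `X`, which lies in the variety and whose preimage under the lift `g`
  -- of `f` is `L`.
  obtain ⟨h, hh⟩ := exists_extension_outD (E := E) hepi (Alg.rangeIncl f.toHom)
    (fun _ _ hab => hab) k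
  let q : D.free (List X.alphabet) ⟶ M.mon.toAlg := M.quot.toHom
  have hmem : E.languageOf (q ≫ h) ∈ (VarietyOfLanguages.at 𝒱 X).langs :=
    (LocalVariety.mem_genMons hC hepi).1 hM (E.languageOf_mem_recognized q h)
  suffices hL : L = E.preimage g (E.languageOf (q ≫ h)) from
    hL ▸ (𝒱.closedUnderPreimages g).preimage_mem hmem
  refine Set.ext fun w => iff_of_eq ((E.eq_extend_iff.1 hk w).symm.trans ?_)
  change _ = E.labelD ((E.extend (E.languageOf (q ≫ h))).toFun (g.toFun (ofGen w)))
  rw [← extend_languageOf, ← hh]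
  exact congrArg (fun m => E.labelD (h.toFun m)) (Mon.congr_toFun hg (ofGen w)).symm

/-- Every variety of languages is determined by the associated pseudovariety. -/
theorem VarietyOfLanguages.recognizedBy_pseudovarietyOf (hC : ¬ C.ordered)
    (hepi : D.EpisSurjective) (𝒱 : E.VarietyOfLanguages) (X : D.FreeMon) :
    E.recognizedBy (pseudovarietyOf hC hepi (VarietyOfLanguages.at 𝒱)) X.alphabet
      = VarietyOfLanguages.at 𝒱 X := by
  refine LocalVariety.ext (Set.ext fun L => ⟨?_, fun hL => ?_⟩)
  · rintro ⟨M, ⟨-, hM⟩, hL⟩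
    -- The defining test is applied to the quotient map of `M` itself: it factors through an `N`
    -- whose languages belong to the variety.
    obtain ⟨N, hN, g, hg⟩ := hM X M.quot
    exact (LocalVariety.mem_genMons hC hepi).1 hN (E.localVariety_mono g hg hL)
  · obtain ⟨W, hW, hLW, hWV⟩ := (VarietyOfLanguages.at 𝒱 X).exists_finite
      (Set.finite_singleton L) (Set.singleton_subset_iff.2 hL)
    obtain ⟨M, rfl⟩ := W.exists_eq_localVariety hepi hW
    exact ⟨M, 𝒱.mem_pseudovarietyOf hC hepi ((LocalVariety.mem_genMons hC hepi).2 hWV),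
      hLW rfl⟩

end Predual

/-! ### The General Variety Theorem -/

theorem mainTheorem1 (C D : AlgVariety.{u}) (hC : ¬ C.ordered)
    [C.IsLocallyFinite] [D.IsLocallyFinite] [D.IsEntropic] (hepi : D.EpisSurjective)
    (E : Predual C D) :
    ∃ Θ : E.VarietyOfLanguages ≃ D.Pseudovariety,
      (∀ (𝒱 : E.VarietyOfLanguages) (M : D.Mon), M ∈ (Θ 𝒱).mons ↔
        Finite M.carrier ∧ ∀ (X : D.FreeMon) (f : X.mon ⟶ M),
          ∃ N ∈ (𝒱.at X).genMons, ∃ g : N.mon ⟶ M, N.quot ≫ g = f) ∧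
      (∀ (𝒬 : D.Pseudovariety) (X : D.FreeMon) (L : Language X.alphabet),
        L ∈ ((Θ.symm 𝒬).at X).langs ↔
          ∃ (W : E.LocalVariety X.alphabet) (M : D.GenMon X.alphabet),
            M.mon ∈ 𝒬.mons ∧ W.Corresponds M ∧ L ∈ W.langs) ∧
      (∀ 𝒱 𝒲 : E.VarietyOfLanguages,
        (∀ X : D.FreeMon, (𝒱.at X).langs ⊆ (𝒲.at X).langs) ↔ (Θ 𝒱).mons ⊆ (Θ 𝒲).mons) := by
  refine ⟨⟨fun 𝒱 => Predual.pseudovarietyOf hC hepi 𝒱.at, E.varietyOf hC,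
    fun 𝒱 => Predual.VarietyOfLanguages.ext (𝒱.recognizedBy_pseudovarietyOf hC hepi),
    Predual.pseudovarietyOf_recognizedBy hC hepi⟩, fun _ _ => Iff.rfl, fun 𝒬 X L => ?_,
    fun 𝒱 𝒲 => ⟨Predual.pseudovarietyOf_mono hC hepi, fun h X => ?_⟩⟩
  · constructor
    · rintro ⟨M, hM, hL⟩
      exact ⟨_, M, hM, (Predual.LocalVariety.corresponds_iff hC hepi).2 rfl, hL⟩
    · rintro ⟨W, M, hM, hW, hL⟩
      exact ⟨M, hM, hW.eq_localVariety ▸ hL⟩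
  -- Inclusion is reflected because each local variety is recovered from the pseudovariety by the
  -- monotone construction `recognizedBy`.
  · rw [← 𝒱.recognizedBy_pseudovarietyOf hC hepi, ← 𝒲.recognizedBy_pseudovarietyOf hC hepi]
    exact Predual.recognizedBy_mono h X.alphabet
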